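/- **Setting.** There are $d$ divisible goods and $n$ buyer types. The feasible set $\mathcal F\subset\mathbb R_{\ge 0}^d$ is convex, closed and satisfies $\|x\|_2\le R$ for all $x\in\mathcal F$; the unit production costs are $c\in\mathbb R_{\ge 0}^d$. Type $i$ occurs with probability $\psi_i$ and has a valuation $v_i\ge 0$ that on $\mathcal F$ is $\sigma$-strongly concave with respect to $\ell_2$ ($\sigma>0$) and satisfies $|v_i(x)-v_i(y)|\le\lambda\|x-y\|_1^{\beta}$ for all $x,y\in\mathcal F$, where $\lambda\ge 1$ and $\beta\in(0,1]$ is an absolute constant. Moreover, either every $v_i$ is nondecreasing in each coordinate on $\mathcal F$ or, more generally, the market is *supply-saturating*: for every $\hat x\in\mathcal F$, every optimal solution $(x_i)_{i\le n}$ of $\max\{\sum_i\psi_i v_i(x_i): x_i\in\mathcal F,\ \sum_i\psi_i x_i\le\hat x\}$ satisfies $\sum_i\psi_i x_i=\hat x$. At prices $p\in\mathbb R_{\ge 0}^d$ a buyer of type $i$ buys $x^*_i(p)=\arg\max_{x\in\mathcal F}\,[v_i(x)-\langle p,x\rangle]$. Put $x^*_\psi(p)=\sum_i\psi_i x^*_i(p)$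 and $\mathrm{SW}(p)=\sum_i\psi_i\,[v_i(x^*_i(p))-\langle c,x^*_i(p)\rangle]$. The revealed-preference oracle, queried at $p\in\mathbb R_{\ge 0}^d$, draws a fresh type $i\sim\psi$ independently and returns $x^*_i(p)$. For a supply vector $s$, let $\mathrm{OPT}^{\mathrm{lot}}(s)$ be the supremum of $\sum_i\psi_i\,\mathbb E[v_i(X_i)-\langle c,X_i\rangle]$ over all lotteries, that is, over all families of random bundles $X_i\in\mathcal F$ with $\sum_i\psi_i\,\mathbb E[X_i]\le s$. Call good $j$ *disposable* if setting the $j$-th coordinate of any bundle in $\mathcal F$ to $0$ gives a bundle in $\mathcal F$. Say that $s$ has *slack* $\gamma>0$ if there is $x^\circ\in\mathcal F$ such that, for every good $j$, either $x^\circ_j+\gamma\le s_j$, or $j$ is disposable and $s_j>0$. (For $\mathcal F=[0,1]^d$, every $s\in\mathbb R_{>0}^d$ has slack $\gamma=1$.) **Theorem.** There is an algorithm OWel, namely one fixed program of a real random-access machine (exact real arithmetic and comparisons at unit cost) with the revealed-preference oracle, such that for every $\beta\in(0,1]$ there are constants $K,k$ depending only on $\beta$ with the following property. For every market as above, all $\alpha>0$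 and $\delta\in(0,1)$, and every supply vector $s$ with slack $\gamma>0$, OWel, given only $d,\alpha,\delta,\lambda,\beta,\sigma,R,\gamma,s,c$ and the oracle, always halts and outputs a price vector $p'\in\mathbb R_{\ge 0}^d$. With probability at least $1-\delta$ over the draws of the buyers, $$x^*_\psi(p')\le s\qquad\text{and}\qquad \mathrm{SW}(p')\ \ge\ \mathrm{OPT}^{\mathrm{lot}}(s)-\alpha .$$ Both the running time and the number of oracle queries are always at most $$K\Big(d+\tfrac1\alpha+\tfrac1\sigma+\lambda+\log\tfrac1\delta+R+\|c\|_2+\tfrac1\gamma\Big)^{k},$$ in particular independent of $n$. -/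

import Mathlib

open MeasureTheory

noncomputable section

namespace PostedPricing

/-! ## Real-number machine with a price oracle

A real RAM: natural-number registers used for indexing (they can only be copied and incremented),
and real arrays with exact unit-cost field operations and comparisons.  There is no rounding
operation and no root, power or logarithm.  Programs are structured; one machine step executes one
instruction (or resolves one control construct) of a fixed program. -/

/-- An index: a literal, or the current content of an index register. -/
inductive Ix where
  | lit (k : ℕ)
  | reg (r : ℕ)

/-- Real expressions: natural literals, array cells, field operations (with `x / 0 = 0`). -/
inductive Expr where
  | lit (k : ℕ)
  | cell (a : ℕ) (i : Ix)
  | add (e f : Expr)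
  | sub (e f : Expr)
  | mul (e f : Expr)
  | div (e f : Expr)

/-- Tests: strict comparison of two reals, or of two indices. -/
inductive Test where
  | realLt (e f : Expr)
  | ixLt (i j : Ix)

/-- Programs. -/
inductive Prog where
  /-- index register `r := i` -/
  | setIx (r : ℕ) (i : Ix)
  /-- index register `r := r + 1` -/
  | incIx (r : ℕ)
  /-- cell `i` of real array `a` `:= e` -/
  | setReal (a : ℕ) (i : Ix) (e : Expr)
  /-- post the prices stored in the first `d` cells of array `a`;
  the purchased bundle is written to the first `d` cells of array `b` -/
  | query (a b : ℕ)
  | seq (P Q : Prog)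
  | branch (t : Test) (P Q : Prog)
  | loop (t : Test) (P : Prog)

/-- Memory: index registers and real arrays. -/
structure Mem where
  ix : ℕ → ℕ
  arr : ℕ → ℕ → ℝ

def Ix.eval (m : Mem) : Ix → ℕ
  | .lit k => k
  | .reg r => m.ix r

def Expr.eval (m : Mem) : Expr → ℝ
  | .lit k => (k : ℝ)
  | .cell a i => m.arr a (i.eval m)
  | .add e f => e.eval m + f.eval m
  | .sub e f => e.eval m - f.eval m
  | .mul e f => e.eval m * f.eval m
  | .div e f => e.eval m / f.eval m

def Test.Holds (m : Mem) : Test → Prop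
  | .realLt e f => e.eval m < f.eval m
  | .ixLt i j => i.eval m < j.eval m

def Mem.setIx (m : Mem) (r k : ℕ) : Mem where
  ix := Function.update m.ix r k
  arr := m.arr

def Mem.setReal (m : Mem) (a i : ℕ) (y : ℝ) : Mem where
  ix := m.ix
  arr := Function.update m.arr a (Function.update (m.arr a) i y)

/-- The vector stored in the first `d` cells of array `a`. -/
def Mem.vec (m : Mem) (d a : ℕ) : Fin d → ℝ := fun j => m.arr a j

/-- The array that holds the vector `x` in its first `d` cells and agrees with `f` elsewhere. -/
def padVec {d : ℕ} (x : Fin d → ℝ) (f : ℕ → ℝ) : ℕ → ℝ :=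
  fun j => if h : j < d then x ⟨j, h⟩ else f j

/-- Overwrite the first `d` cells of array `a` by the vector `x`. -/
def Mem.setVec {d : ℕ} (m : Mem) (a : ℕ) (x : Fin d → ℝ) : Mem where
  ix := m.ix
  arr := Function.update m.arr a (padVec x (m.arr a))

/-- A configuration: the programs still to be executed (first one first), the memory, and the
number of oracle queries made so far. -/
structure Config where
  todo : List Prog
  mem : Mem
  queries : ℕ

open scoped Classical in
/-- One machine step.  `O t p` is the oracle's answer to the `t`-th query (counted from `0`) when
it is asked at the price vector `p`.  Only nonnegative price vectors may be posted: a machine that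
tries to post anything else is stuck forever and never halts. -/
def step {d : ℕ} (O : ℕ → (Fin d → ℝ) → (Fin d → ℝ)) : Config → Config
  | ⟨[], m, q⟩ => ⟨[], m, q⟩
  | ⟨.setIx r i :: k, m, q⟩ => ⟨k, m.setIx r (i.eval m), q⟩
  | ⟨.incIx r :: k, m, q⟩ => ⟨k, m.setIx r (m.ix r + 1), q⟩
  | ⟨.setReal a i e :: k, m, q⟩ => ⟨k, m.setReal a (i.eval m) (e.eval m), q⟩
  | ⟨.query a b :: k, m, q⟩ =>
      if ∀ j, 0 ≤ m.vec d a j then ⟨k, m.setVec b (O q (m.vec d a)), q + 1⟩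
      else ⟨.query a b :: k, m, q⟩
  | ⟨.seq P Q :: k, m, q⟩ => ⟨P :: Q :: k, m, q⟩
  | ⟨.branch t P Q :: k, m, q⟩ => ⟨(if t.Holds m then P else Q) :: k, m, q⟩
  | ⟨.loop t P :: k, m, q⟩ => ⟨if t.Holds m then P :: .loop t P :: k else k, m, q⟩

/-- Started on memory `m₀`, the program `P` halts after at most `T` steps, having made `q` queries,
with final memory `m`. -/
def Halts {d : ℕ} (O : ℕ → (Fin d → ℝ) → (Fin d → ℝ)) (P : Prog) (m₀ : Mem) (T q : ℕ)
    (m : Mem) : Prop :=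
  ∃ t ≤ T, (step O)^[t] ⟨[P], m₀, 0⟩ = ⟨[], m, q⟩

/-! ## The market -/

/-- Bundles of `d` divisible goods, with the `ℓ₂` norm. -/
abbrev Bundle (d : ℕ) := EuclideanSpace ℝ (Fin d)

/-- `d` goods; `n` buyer types; the feasible set `F` of bundles, the valuation `v i` of the buyers
of type `i`, the distribution `ψ` of the type of a random buyer, and the unit production costs. -/
structure Market (d n : ℕ) where
  F : Set (Bundle d)
  v : Fin n → Bundle d → ℝ
  ψ : PMF (Fin n)
  cost : Bundle d

/-- `⟨p, x⟩` -/
def pay {d : ℕ} (p : Fin d → ℝ) (x : Bundle d) : ℝ := ∑ j, p j * x j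

/-- The bundle bought under prices `p`: the maximizer over `F` of `v x - ⟨p, x⟩` (it exists and is
unique when `F` is nonempty and compact and `v` is continuous and strictly concave on `F`). -/
def demand {d : ℕ} (F : Set (Bundle d)) (v : Bundle d → ℝ) (p : Fin d → ℝ) : Bundle d :=
  Classical.epsilon fun x => x ∈ F ∧ ∀ y ∈ F, v y - pay p y ≤ v x - pay p x

namespace Market

variable {d n : ℕ}

/-- Expectation over the type of a random buyer. -/
def expect (M : Market d n) (f : Fin n → ℝ) : ℝ := ∑ i, (M.ψ i).toReal * f i

/-- Expected purchase of good `j` by a random buyer under prices `p`. -/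
def expDemand (M : Market d n) (p : Fin d → ℝ) (j : Fin d) : ℝ :=
  M.expect fun i => demand M.F (M.v i) p j

/-- Expected social welfare under prices `p`: value minus production cost of the purchase. -/
def welfare (M : Market d n) (p : Fin d → ℝ) : ℝ :=
  M.expect fun i => M.v i (demand M.F (M.v i) p) - pay M.cost (demand M.F (M.v i) p)

/-- The revealed preference oracle, when the types of the successive buyers are `ω 0, ω 1, …`. -/
def rep (M : Market d n) (ω : ℕ → Fin n) : ℕ → (Fin d → ℝ) → (Fin d → ℝ) :=
  fun t p j => demand M.F (M.v (ω t)) p j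

/-- The law of the sequence of types of the arriving buyers: independent draws from `ψ`. -/
def buyers (M : Market d n) : Measure (ℕ → Fin n) :=
  Measure.infinitePi fun _ : ℕ => M.ψ.toMeasure

/-- Feasibility in the stochastic convex program with supply `xhat`: every type gets a bundle in
`F`, and the expected allocation is at most `xhat`. -/
def SCPFeasible (M : Market d n) (xhat : Bundle d) (x : Fin n → Bundle d) : Prop :=
  (∀ i, x i ∈ M.F) ∧ ∀ j, M.expect (fun i => x i j) ≤ xhat j

/-- Optimality in the stochastic convex program: maximal expected value. -/
def SCPOptimal (M : Market d n) (xhat : Bundle d) (x : Fin n → Bundle d) : Prop :=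
  M.SCPFeasible xhat x ∧
    ∀ y, M.SCPFeasible xhat y → M.expect (fun i => M.v i (y i)) ≤ M.expect fun i => M.v i (x i)

/-- For each supply in `F`, optimal solutions use up the whole supply. -/
def SupplySaturating (M : Market d n) : Prop :=
  ∀ xhat ∈ M.F, ∀ x, M.SCPOptimal xhat x → ∀ j, M.expect (fun i => x i j) = xhat j

/-- Every valuation is nondecreasing in each coordinate on `F`. -/
def MonotoneValuations (M : Market d n) : Prop :=
  ∀ i, ∀ x ∈ M.F, ∀ y ∈ M.F, (∀ j, x j ≤ y j) → M.v i x ≤ M.v i y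

/-- The standing assumptions on the feasible set, the costs and the valuations. -/
structure Regular (M : Market d n) (lam β σ R : ℝ) : Prop where
  convex : Convex ℝ M.F
  closed : IsClosed M.F
  orthant : ∀ x ∈ M.F, ∀ j, 0 ≤ x j
  bounded : ∀ x ∈ M.F, ‖x‖ ≤ R
  cost_nonneg : ∀ j, 0 ≤ M.cost j
  value_nonneg : ∀ i, ∀ x ∈ M.F, 0 ≤ M.v i x
  one_le_lam : 1 ≤ lam
  holder : ∀ i, ∀ x ∈ M.F, ∀ y ∈ M.F, |M.v i x - M.v i y| ≤ lam * (∑ j, |x j - y j|) ^ β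
  sigma_pos : 0 < σ
  concave : ∀ i, StrongConcaveOn M.F σ (M.v i)
  saturating : M.MonotoneValuations ∨ M.SupplySaturating

/-- Good `j` is disposable: dropping it from a feasible bundle leaves a feasible bundle. -/
def Disposable (M : Market d n) (j : Fin d) : Prop :=
  ∀ x ∈ M.F, ∀ y : Bundle d, y j = 0 → (∀ k, k ≠ j → y k = x k) → y ∈ M.F

/-- The supply `s` is strictly satisfiable with room `γ`: some feasible bundle stays `γ` below the
supply in every good, except possibly in disposable goods, whose supply only has to be positive.
If all goods are disposable (such as for `F = [0,1]^d`), then this just says that `s` is positive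
(and `F` nonempty), whatever `γ` is. -/
def HasSlack (M : Market d n) (s : Fin d → ℝ) (γ : ℝ) : Prop :=
  ∃ x ∈ M.F, ∀ j, x j + γ ≤ s j ∨ (M.Disposable j ∧ 0 < s j)

/-- A lottery over allocations gives each type a random bundle in `F`; it respects the supply `s`
if the expected allocation to a random buyer is at most `s`. -/
structure IsLottery (M : Market d n) (s : Fin d → ℝ) (π : Fin n → Measure (Bundle d)) :
    Prop where
  prob : ∀ i, IsProbabilityMeasure (π i)
  feasible : ∀ i, ∀ᵐ x ∂(π i), x ∈ M.F
  supply : ∀ j, M.expect (fun i => ∫ x, x j ∂(π i)) ≤ s j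

/-- Expected welfare of a lottery. -/
def lotteryWelfare (M : Market d n) (π : Fin n → Measure (Bundle d)) : ℝ :=
  M.expect fun i => ∫ x, (M.v i x - pay M.cost x) ∂(π i)

/-- The optimal welfare of a lottery over allocations with expected supply `s`. -/
def optLottery (M : Market d n) (s : Fin d → ℝ) : ℝ :=
  sSup {w | ∃ π, M.IsLottery s π ∧ M.lotteryWelfare π = w}

end Market

/-- The initial memory: index register `0` holds `d`; array `0` holds the parameters
`α, δ, λ, β, σ, R, γ`; array `1` the supply vector; array `2` the costs; all else is zero.
In particular the program is given neither the valuations, nor `ψ`, nor `F`. -/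
def inputMem {d : ℕ} (α δ lam β σ R γ : ℝ) (s cost : Fin d → ℝ) : Mem where
  ix := Function.update 0 0 d
  arr a :=
    if a = 0 then padVec ![α, δ, lam, β, σ, R, γ] 0
    else if a = 1 then padVec s 0
    else if a = 2 then padVec cost 0
    else 0

/-- The array that holds the output when the program halts. -/
def outArr : ℕ := 3

end PostedPricing

end

/-! The algorithm is stochastic gradient descent on the Lagrangian dual of welfare maximization
(`Market.dual`), a function of the prices. Strong concavity of the valuations makes the dual smooth
with constant `1 / σ` (`Regular.dual_le`). Its gradient at `p` is the target supply minus the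
expected demand, which a batch of observed purchases estimates; hence `n` never enters.

The target is a trimmed supply. Goods with supply below `room` are disposable, by the slack. They
keep a fixed price at which no buyer takes more than `s j` (`Regular.demand_le_of_price`), and
forgoing them costs the optimum at most `λ (d * room) ^ β` (`Regular.exists_dropped`). For every
other good the target is `s j`, capped at `R + 1`, less a small `margin`; this reserve absorbs all
errors, so the supply constraint holds exactly.

Each round with a substantial price change lowers the dual by a fixed amount (`dual_succ_le`). A
feasible bundle that leaves `room` of every non-scarce good bounds the dual below by its welfare
plus `room / 2` times the total markup (`le_dual`), and the initial dual exceeds that welfare by at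
most `gap` (`dual_start_le`). So the descent stops before its round limit, with a bounded markup
(`exists_stopped`). Where it stops, the optimality conditions hold approximately (`stationary`):
demand is within supply, and markup times unused target sums to at most `acc / 4`. Welfare is the
dual minus that sum (`welfare_eq`), and by weak duality the dual dominates the welfare of any
allocation within the target. A lottery becomes one by passing to mean bundles (Jensen), dropping
the scarce goods, and moving slightly towards the interior bundle. This costs `acc / 4` twice more,
and `acc ≤ α`.

The prices of a round depend only on earlier buyers, so the deviations within a batch are bounded
martingale differences. A Chernoff bound and a union bound over rounds and goods make all estimates
accurate with probability `1 - δ`. The machine has no real powers, so `room` is built with the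
integer exponent `pow ≥ 1 / β`; this is why the degree of the running time depends on `β`. -/

namespace PostedPricing

/-! ## Running structured programs -/

section Machine

variable {d : ℕ} {O : ℕ → (Fin d → ℝ) → (Fin d → ℝ)}

/-- Started on memory `m` with `q` queries made, `P` finishes after at most `C` steps with memory
`m'` and `q'` queries made, whatever program is to be executed afterwards. -/
def Run (O : ℕ → (Fin d → ℝ) → (Fin d → ℝ)) (P : Prog) (m : Mem) (q : ℕ) (m' : Mem) (q' C : ℕ) :
    Prop :=
  ∃ t ≤ C, ∀ k, (step O)^[t] ⟨P :: k, m, q⟩ = ⟨k, m', q'⟩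

theorem Run.mono {P : Prog} {m m' : Mem} {q q' C C' : ℕ} (h : Run O P m q m' q' C) (hC : C ≤ C') :
    Run O P m q m' q' C' := by
  obtain ⟨t, ht, h⟩ := h
  exact ⟨t, ht.trans hC, h⟩

theorem Run.setIx (r : ℕ) (i : Ix) (m : Mem) (q : ℕ) :
    Run O (.setIx r i) m q (m.setIx r (i.eval m)) q 1 :=
  ⟨1, le_rfl, fun _ => rfl⟩

theorem Run.incIx (r : ℕ) (m : Mem) (q : ℕ) :
    Run O (.incIx r) m q (m.setIx r (m.ix r + 1)) q 1 :=
  ⟨1, le_rfl, fun _ => rfl⟩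

theorem Run.setReal (a : ℕ) (i : Ix) (e : Expr) (m : Mem) (q : ℕ) :
    Run O (.setReal a i e) m q (m.setReal a (i.eval m) (e.eval m)) q 1 :=
  ⟨1, le_rfl, fun _ => rfl⟩

theorem Run.query (a b : ℕ) (m : Mem) (q : ℕ) (h : ∀ j, 0 ≤ m.vec d a j) :
    Run O (.query a b) m q (m.setVec b (O q (m.vec d a))) (q + 1) 1 :=
  ⟨1, le_rfl, fun _ => by simp only [Function.iterate_one, step, if_pos h]⟩

theorem Run.seq {P Q : Prog} {m m₁ m₂ : Mem} {q q₁ q₂ C₁ C₂ : ℕ} (hP : Run O P m q m₁ q₁ C₁)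
    (hQ : Run O Q m₁ q₁ m₂ q₂ C₂) : Run O (.seq P Q) m q m₂ q₂ (C₁ + C₂ + 1) := by
  obtain ⟨t₁, ht₁, h₁⟩ := hP
  obtain ⟨t₂, ht₂, h₂⟩ := hQ
  refine ⟨t₂ + (t₁ + 1), by omega, fun k => ?_⟩
  rw [Function.iterate_add_apply, Function.iterate_add_apply, Function.iterate_one, step, h₁, h₂]

theorem Run.branch_true {P Q : Prog} {t : Test} {m m' : Mem} {q q' C : ℕ} (ht : t.Holds m)
    (h : Run O P m q m' q' C) : Run O (.branch t P Q) m q m' q' (C + 1) := by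
  obtain ⟨n, hn, h⟩ := h
  refine ⟨n + 1, by omega, fun k => ?_⟩
  rw [Function.iterate_add_apply, Function.iterate_one, step, if_pos ht, h]

theorem Run.branch_false {P Q : Prog} {t : Test} {m m' : Mem} {q q' C : ℕ} (ht : ¬ t.Holds m)
    (h : Run O Q m q m' q' C) : Run O (.branch t P Q) m q m' q' (C + 1) := by
  obtain ⟨n, hn, h⟩ := h
  refine ⟨n + 1, by omega, fun k => ?_⟩
  rw [Function.iterate_add_apply, Function.iterate_one, step, if_neg ht, h]

theorem Run.loop_exit {P : Prog} {t : Test} {m : Mem} {q : ℕ} (ht : ¬ t.Holds m) :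
    Run O (.loop t P) m q m q 1 :=
  ⟨1, le_rfl, fun k => by rw [Function.iterate_one, step, if_neg ht]⟩

theorem Run.loop_step {P : Prog} {t : Test} {m m₁ m₂ : Mem} {q q₁ q₂ C₁ C₂ : ℕ} (ht : t.Holds m)
    (hP : Run O P m q m₁ q₁ C₁) (hL : Run O (.loop t P) m₁ q₁ m₂ q₂ C₂) :
    Run O (.loop t P) m q m₂ q₂ (C₁ + C₂ + 1) := by
  obtain ⟨t₁, ht₁, h₁⟩ := hP
  obtain ⟨t₂, ht₂, h₂⟩ := hL
  refine ⟨t₂ + (t₁ + 1), by omega, fun k => ?_⟩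
  rw [Function.iterate_add_apply, Function.iterate_add_apply, Function.iterate_one, step,
    if_pos ht, h₁, h₂]

theorem step_queries_le (c : Config) : (step O c).queries ≤ c.queries + 1 := by
  rcases c with ⟨_ | ⟨P, k⟩, m, q⟩
  · exact Nat.le_succ q
  · cases P <;> simp only [step] <;> try exact Nat.le_succ q
    split_ifs
    · exact le_rfl
    · exact Nat.le_succ q

theorem iterate_step_queries_le (c : Config) (t : ℕ) :
    ((step O)^[t] c).queries ≤ c.queries + t := by
  induction t with
  | zero => exact le_rfl
  | succ t ih =>
    rw [Function.iterate_succ_apply']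
    have := step_queries_le (O := O) ((step O)^[t] c)
    omega

/-- A machine step makes at most one query, so the step bound also bounds the queries. -/
theorem Run.halts {P : Prog} {m m' : Mem} {q C : ℕ} (h : Run O P m 0 m' q C) :
    Halts O P m C q m' ∧ q ≤ C := by
  obtain ⟨t, ht, h⟩ := h
  refine ⟨⟨t, ht, h []⟩, ?_⟩
  have := iterate_step_queries_le (O := O) ⟨[P], m, 0⟩ t
  rw [h []] at this
  simp only at this
  omega

/-- `P` takes every memory with `d` in register `0` that satisfies `pre` to one that satisfies
`post`, in at most `C` steps. -/
def Spec (O : ℕ → (Fin d → ℝ) → (Fin d → ℝ)) (P : Prog) (pre post : (ℕ → ℕ → ℝ) → ℕ → Prop)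
    (C : ℕ) : Prop :=
  ∀ m q, m.ix 0 = d → pre m.arr q →
    ∃ m' q', Run O P m q m' q' C ∧ m'.ix 0 = d ∧ post m'.arr q'

theorem Spec.seq {P Q : Prog} {f g h : (ℕ → ℕ → ℝ) → ℕ → Prop} {C₁ C₂ : ℕ}
    (hP : Spec O P f g C₁) (hQ : Spec O Q g h C₂) : Spec O (.seq P Q) f h (C₁ + C₂ + 1) := by
  intro m q hd hf
  obtain ⟨m₁, q₁, r₁, hd₁, h₁⟩ := hP m q hd hf
  obtain ⟨m₂, q₂, r₂, hd₂, h₂⟩ := hQ m₁ q₁ hd₁ h₁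
  exact ⟨m₂, q₂, r₁.seq r₂, hd₂, h₂⟩

theorem Spec.weaken {P : Prog} {f g f' g' : (ℕ → ℕ → ℝ) → ℕ → Prop} {C C' : ℕ}
    (h : Spec O P f g C) (hf : ∀ A q, f' A q → f A q) (hg : ∀ A q, g A q → g' A q)
    (hC : C ≤ C') : Spec O P f' g' C' := by
  intro m q hd hp
  obtain ⟨m', q', r, hd', hq⟩ := h m q hd (hf _ _ hp)
  exact ⟨m', q', r.mono hC, hd', hg _ _ hq⟩

theorem Spec.setReal {a i : ℕ} {e : Expr} {f g : (ℕ → ℕ → ℝ) → ℕ → Prop}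
    (h : ∀ m q, f m.arr q →
      g (Function.update m.arr a (Function.update (m.arr a) i (e.eval m))) q) :
    Spec O (.setReal a (.lit i) e) f g 1 := by
  intro m q hd hf
  exact ⟨_, q, Run.setReal _ _ _ _ _, hd, h m q hf⟩

/-- Loops with an invariant and a known number of rounds. -/
theorem Spec.loop {P : Prog} {t : Test} (I : ℕ → (ℕ → ℕ → ℝ) → ℕ → Prop) (n C : ℕ)
    (hbody : ∀ k < n, Spec O P (I k) (I (k + 1)) C)
    (hgo : ∀ k < n, ∀ m q, m.ix 0 = d → I k m.arr q → t.Holds m)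
    (hend : ∀ m q, m.ix 0 = d → I n m.arr q → ¬ t.Holds m) :
    Spec O (.loop t P) (I 0) (I n) (n * (C + 1) + 1) := by
  suffices H : ∀ r k, k + r = n → Spec O (.loop t P) (I k) (I n) (r * (C + 1) + 1) from
    H n 0 (Nat.zero_add n)
  intro r
  induction r with
  | zero =>
    rintro k rfl m q hd hI
    exact ⟨m, q, (Run.loop_exit (hend m q hd hI)).mono (by omega), hd, hI⟩
  | succ r ih =>
    intro k hk m q hd hI
    obtain ⟨m₁, q₁, r₁, hd₁, h₁⟩ := hbody k (by omega) m q hd hI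
    obtain ⟨m₂, q₂, r₂, hd₂, h₂⟩ := ih (k + 1) (by omega) m₁ q₁ hd₁ h₁
    refine ⟨m₂, q₂, (Run.loop_step (hgo k (by omega) m q hd hI) r₁ r₂).mono ?_, hd₂, h₂⟩
    rw [Nat.succ_mul]
    omega

/-- `for` every good, whose index is put into register `1`, `do P`. -/
def forGoods (P : Prog) : Prog :=
  .seq (.setIx 1 (.lit 0)) (.loop (.ixLt (.reg 1) (.reg 0)) (.seq P (.incIx 1)))

/-- The invariant sees only the arrays, so the body must preserve all index registers: register `1`
is the counter and register `0` the bound. Loop test, unpacking of `seq` and increment add three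
steps per good. -/
theorem Spec.forGoods {P : Prog} (I : ℕ → (ℕ → ℕ → ℝ) → ℕ → Prop) (C : ℕ)
    (hbody : ∀ k < d, ∀ m q, m.ix 1 = k → I k m.arr q →
      ∃ m', Run O P m q m' q C ∧ m'.ix = m.ix ∧ I (k + 1) m'.arr q) :
    Spec O (forGoods P) (I 0) (I d) (d * (C + 3) + 3) := by
  intro m q hd hI
  suffices H : ∀ r k, k + r = d → ∀ m : Mem, m.ix 0 = d → m.ix 1 = k → I k m.arr q →
      ∃ m', Run O (.loop (.ixLt (.reg 1) (.reg 0)) (.seq P (.incIx 1))) m q m' q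
        (r * (C + 3) + 1) ∧ m'.ix 0 = d ∧ I d m'.arr q by
    obtain ⟨m', r, hd', h⟩ := H d 0 (Nat.zero_add d) (m.setIx 1 0) hd rfl hI
    exact ⟨m', q, ((Run.setIx 1 (.lit 0) m q).seq r).mono (by omega), hd', h⟩
  intro r
  induction r with
  | zero =>
    rintro k rfl m hd hk hI
    refine ⟨m, (Run.loop_exit ?_).mono (by omega), hd, hI⟩
    simp only [Test.Holds, Ix.eval, hd, hk]
    omega
  | succ r ih =>
    intro k hkr m hd hk hI
    obtain ⟨m₁, r₁, hix, h₁⟩ := hbody k (by omega) m q hk hI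
    obtain ⟨m₂, r₂, hd₂, h₂⟩ := ih (k + 1) (by omega) (m₁.setIx 1 (m₁.ix 1 + 1))
      (by simp [Mem.setIx, hix, hd]) (by simp [Mem.setIx, hix, hk]) h₁
    refine ⟨m₂, (Run.loop_step ?_ (r₁.seq (Run.incIx 1 m₁ q)) r₂).mono ?_, hd₂, h₂⟩
    · simp only [Test.Holds, Ix.eval, hd, hk]
      omega
    · rw [Nat.succ_mul]
      omega

end Machine

end PostedPricing

namespace PostedPricing

/-! ## The pricing program -/

instance : Add Expr := ⟨.add⟩
instance : Sub Expr := ⟨.sub⟩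
instance : Mul Expr := ⟨.mul⟩
instance : Div Expr := ⟨.div⟩

@[simp] theorem Expr.eval_add (m : Mem) (e f : Expr) : (e + f).eval m = e.eval m + f.eval m := rfl
@[simp] theorem Expr.eval_sub (m : Mem) (e f : Expr) : (e - f).eval m = e.eval m - f.eval m := rfl
@[simp] theorem Expr.eval_mul (m : Mem) (e f : Expr) : (e * f).eval m = e.eval m * f.eval m := rfl
@[simp] theorem Expr.eval_div (m : Mem) (e f : Expr) : (e / f).eval m = e.eval m / f.eval m := rfl
@[simp] theorem Expr.eval_lit (m : Mem) (k : ℕ) : (Expr.lit k).eval m = k := rfl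
@[simp] theorem Expr.eval_cell_lit (m : Mem) (a k : ℕ) :
    (Expr.cell a (.lit k)).eval m = m.arr a k := rfl
@[simp] theorem Expr.eval_cell_reg (m : Mem) (a r : ℕ) :
    (Expr.cell a (.reg r)).eval m = m.arr a (m.ix r) := rfl
@[simp] theorem Test.holds_realLt (m : Mem) (e f : Expr) :
    (Test.realLt e f).Holds m ↔ e.eval m < f.eval m := Iff.rfl
@[simp] theorem Mem.setReal_ix (m : Mem) (a i : ℕ) (y : ℝ) : (m.setReal a i y).ix = m.ix := rfl
@[simp] theorem Mem.setReal_arr (m : Mem) (a i : ℕ) (y : ℝ) :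
    (m.setReal a i y).arr = Function.update m.arr a (Function.update (m.arr a) i y) := rfl

/-- The input parameter number `k`. -/
abbrev par (k : ℕ) : Expr := .cell 0 (.lit k)
/-- The constant number `k` computed from the input. -/
abbrev sca (k : ℕ) : Expr := .cell 9 (.lit k)
/-- The working variable number `k`. -/
abbrev wrk (k : ℕ) : Expr := .cell 10 (.lit k)
/-- The entry of array `a` for the current good. -/
abbrev cur (a : ℕ) : Expr := .cell a (.reg 1)

/-- Sample the demand at the current prices and add up the bundles in array `5`. -/
def sampleProg : Prog :=
  -- Memory layout: arrays `0`, `1`, `2` hold the input, `3` the prices, `4` the last purchase, `5`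
  -- the batch sum, `6` the targets, `7` the step sizes, `8` the next prices, `9` the constants. In
  -- array `10`, cell `0` counts rounds, cell `1` counts samples, and cell `2` flags a substantial
  -- move.
  .seq (forGoods (.setReal 5 (.reg 1) (.lit 0))) <|
  .seq (.setReal 10 (.lit 1) (.lit 0)) <|
  .loop (.realLt (wrk 1) (sca 14)) <|
  .seq (.query 3 4) <|
  .seq (forGoods (.setReal 5 (.reg 1) (cur 5 + cur 4)))
    (.setReal 10 (.lit 1) (wrk 1 + .lit 1))

/-- The gradient step for one good. -/
def moveProg : Prog :=
  .seq (.branch (.realLt (cur 3 - cur 7 * (cur 6 - cur 5 / wrk 1)) (cur 2))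
    (.setReal 8 (.reg 1) (cur 2))
    (.setReal 8 (.reg 1) (cur 3 - cur 7 * (cur 6 - cur 5 / wrk 1)))) <|
  .branch (.realLt (sca 15) ((cur 8 - cur 3) * (cur 8 - cur 3)))
    (.setReal 10 (.lit 2) (.lit 1))
    (.setReal 10 (.lit 2) (wrk 2))

/-- One round of the descent. -/
def roundProg : Prog :=
  .seq sampleProg <|
  .seq (.seq (.setReal 10 (.lit 2) (.lit 0)) (forGoods moveProg)) <|
  .branch (.realLt (.lit 0) (wrk 2))
    (.seq (forGoods (.setReal 3 (.reg 1) (cur 8))) (.setReal 10 (.lit 0) (wrk 0 + .lit 1)))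
    (.setReal 10 (.lit 0) (sca 13))

/-- The descent. -/
def descentProg : Prog :=
  .seq (.setReal 10 (.lit 0) (.lit 0)) <|
  .loop (.realLt (wrk 0) (sca 13)) roundProg

/-- The parameters of a projected stochastic gradient descent with batches: lower bounds `low` on
the prices, aimed expected sales `target`, step sizes `rate`, initial prices `start`, a bound on
the number of rounds, the batch size, and the square of the price change that counts as a move. -/
structure Descent (d : ℕ) where
  low : Fin d → ℝ
  target : Fin d → ℝ
  rate : Fin d → ℝ
  start : Fin d → ℝ
  rounds : ℝ
  batch : ℝ
  thr : ℝ

/-! ### The descent as a mathematical process, and the program that carries it out. -/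

namespace Descent

variable {d : ℕ} (D : Descent d) (O : ℕ → (Fin d → ℝ) → (Fin d → ℝ))

/-- The number of samples in a batch. -/
noncomputable def size : ℕ := ⌈D.batch⌉₊

/-- The average purchase in the batch of round `t`, made at prices `p`. -/
noncomputable def mean (t : ℕ) (p : Fin d → ℝ) (j : Fin d) : ℝ :=
  (∑ i ∈ Finset.range D.size, O (t * D.size + i) p j) / D.size

/-- The prices after `t` rounds, without stopping. -/
noncomputable def traj : ℕ → Fin d → ℝ
  | 0 => D.start
  | t + 1 => fun j =>
      max (D.low j) (traj t j - D.rate j * (D.target j - D.mean O t (traj t) j))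

/-- Some price changes substantially in round `t`. -/
def Moves (t : ℕ) : Prop :=
  ∃ j, D.thr < (D.traj O (t + 1) j - D.traj O t j) * (D.traj O (t + 1) j - D.traj O t j)

open scoped Classical in
/-- The prices found by at most `r` more rounds after round `t`. -/
noncomputable def stopped : ℕ → ℕ → Fin d → ℝ
  | 0, t => D.traj O t
  | r + 1, t => if D.Moves O t then stopped r (t + 1) else D.traj O t

/-- The stopping rule only selects a time `u` on the trajectory without stopping. The probabilistic
estimates can thus be made on that trajectory, whose round `t` always uses the queries from `t *
size` on. -/
theorem stopped_eq (r t : ℕ) : ∃ u, t ≤ u ∧ u ≤ t + r ∧ D.stopped O r t = D.traj O u ∧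
    (∀ v, t ≤ v → v < u → D.Moves O v) ∧ (u < t + r → ¬ D.Moves O u) := by
  induction r generalizing t with
  | zero => exact ⟨t, le_rfl, le_rfl, rfl, fun v h h' => by omega, fun h => by omega⟩
  | succ r ih =>
    by_cases hm : D.Moves O t
    · obtain ⟨u, h₁, h₂, h₃, h₄, h₅⟩ := ih (t + 1)
      refine ⟨u, by omega, by omega, by rw [stopped, if_pos hm, h₃], fun v hv hvu => ?_,
        fun h => h₅ (by omega)⟩
      rcases hv.eq_or_lt with rfl | hv
      · exact hm
      · exact h₄ v hv hvu
    · exact ⟨t, le_rfl, by omega, by rw [stopped, if_neg hm], fun v h h' => by omega, fun _ => hm⟩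

/-- The constants and vectors of the descent are in memory. -/
def Loaded (A : ℕ → ℕ → ℝ) : Prop :=
  A 9 13 = D.rounds ∧ A 9 14 = D.batch ∧ A 9 15 = D.thr ∧
    ∀ j : Fin d, A 2 j = D.low j ∧ A 6 j = D.target j ∧ A 7 j = D.rate j

theorem Loaded.congr {D : Descent d} {A A' : ℕ → ℕ → ℝ} (h : D.Loaded A) (h₂ : A' 2 = A 2)
    (h₆ : A' 6 = A 6) (h₇ : A' 7 = A 7) (h₉ : A' 9 = A 9) : D.Loaded A' := by
  unfold Loaded
  rw [h₂, h₆, h₇, h₉]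
  exact h

/-- The descent is loaded, `p` are the current prices and `t` is the round. -/
def At (p : Fin d → ℝ) (t : ℝ) (A : ℕ → ℕ → ℝ) : Prop :=
  D.Loaded A ∧ (∀ j : Fin d, A 3 j = p j) ∧ A 10 0 = t

/-- In the middle of a batch. -/
def Sampled (p : Fin d → ℝ) (t : ℝ) (q₀ k : ℕ) (A : ℕ → ℕ → ℝ) (q : ℕ) : Prop :=
  D.At p t A ∧ q = q₀ + k ∧ A 10 1 = k ∧
    ∀ j : Fin d, A 5 j = ∑ i ∈ Finset.range k, O (q₀ + i) p j

theorem sampleProg_spec (p : Fin d → ℝ) (hp : ∀ j, 0 ≤ p j) (t : ℝ) (q₀ : ℕ) :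
    Spec O sampleProg (fun A q => D.At p t A ∧ q = q₀) (D.Sampled O p t q₀ D.size)
      (d * 4 + D.size * (d * 4 + 8) + 8) := by
  have h1 : Spec O (forGoods (.setReal 5 (.reg 1) (.lit 0)))
      (fun A q => D.At p t A ∧ q = q₀)
      (fun A q => (D.At p t A ∧ q = q₀) ∧ ∀ j : Fin d, A 5 j = 0) (d * (1 + 3) + 3) := by
    refine (Spec.forGoods (fun k A q => (D.At p t A ∧ q = q₀) ∧ ∀ j : Fin d, j.1 < k → A 5 j = 0)
      1 ?_).weaken (fun A q h => ⟨h, fun j hj => absurd hj (by omega)⟩)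
      (fun A q h => ⟨h.1, fun j => h.2 j j.2⟩) le_rfl
    rintro k hk m q hix ⟨⟨⟨hl, h3, h10⟩, hq⟩, h5⟩
    refine ⟨_, Run.setReal _ _ _ _ _, rfl,
      ⟨⟨hl.congr rfl rfl rfl rfl, h3, h10⟩, hq⟩, fun j hj => ?_⟩
    by_cases hjk : j.1 = k
    · simp [Ix.eval, hix, hjk]
    · simp [Ix.eval, hix, hjk, h5 j (by omega)]
  have h2 : Spec O (.setReal 10 (.lit 1) (.lit 0))
      (fun A q => (D.At p t A ∧ q = q₀) ∧ ∀ j : Fin d, A 5 j = 0) (D.Sampled O p t q₀ 0) 1 := by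
    refine Spec.setReal ?_
    rintro m q ⟨⟨⟨hl, h3, h10⟩, hq⟩, h5⟩
    exact ⟨⟨hl.congr rfl rfl rfl rfl, h3, by simpa using h10⟩, hq, by simp, by simpa using h5⟩
  have h3 : Spec O (.loop (.realLt (wrk 1) (sca 14)) <|
      .seq (.query 3 4) <| .seq (forGoods (.setReal 5 (.reg 1) (cur 5 + cur 4)))
        (.setReal 10 (.lit 1) (wrk 1 + .lit 1)))
      (D.Sampled O p t q₀ 0) (D.Sampled O p t q₀ D.size) (D.size * (d * 4 + 7 + 1) + 1) := by
    refine Spec.loop (D.Sampled O p t q₀) D.size _ ?_ ?_ ?_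
    · intro k hk
      have hq : Spec O (.query 3 4) (D.Sampled O p t q₀ k)
          (fun A q => D.At p t A ∧ q = q₀ + (k + 1) ∧ A 10 1 = k ∧
            (∀ j : Fin d, A 5 j = ∑ i ∈ Finset.range k, O (q₀ + i) p j) ∧
            ∀ j : Fin d, A 4 j = O (q₀ + k) p j) 1 := by
        rintro m q hd ⟨⟨hl, h3, h10⟩, rfl, h1, h5⟩
        have hv : m.vec d 3 = p := funext h3
        refine ⟨_, _, Run.query 3 4 m _ (by rw [hv]; exact hp), hd,
          ⟨hl.congr rfl rfl rfl rfl, h3, h10⟩, rfl, h1, h5, fun j => ?_⟩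
        simp [Mem.setVec, padVec, hv]
      have ha : Spec O (forGoods (.setReal 5 (.reg 1) (cur 5 + cur 4)))
          (fun A q => D.At p t A ∧ q = q₀ + (k + 1) ∧ A 10 1 = k ∧
            (∀ j : Fin d, A 5 j = ∑ i ∈ Finset.range k, O (q₀ + i) p j) ∧
            ∀ j : Fin d, A 4 j = O (q₀ + k) p j)
          (fun A q => D.At p t A ∧ q = q₀ + (k + 1) ∧ A 10 1 = k ∧
            ∀ j : Fin d, A 5 j = ∑ i ∈ Finset.range (k + 1), O (q₀ + i) p j)
          (d * (1 + 3) + 3) := by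
        refine (Spec.forGoods (fun l A q => D.At p t A ∧ q = q₀ + (k + 1) ∧ A 10 1 = k ∧
            (∀ j : Fin d, l ≤ j.1 → A 5 j = ∑ i ∈ Finset.range k, O (q₀ + i) p j) ∧
            (∀ j : Fin d, A 4 j = O (q₀ + k) p j) ∧
            (∀ j : Fin d, j.1 < l → A 5 j = ∑ i ∈ Finset.range (k + 1), O (q₀ + i) p j))
          1 ?_).weaken
          (fun A q h => ⟨h.1, h.2.1, h.2.2.1, fun j _ => h.2.2.2.1 j, h.2.2.2.2,
            fun j hj => absurd hj (by omega)⟩)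
          (fun A q h => ⟨h.1, h.2.1, h.2.2.1, fun j => h.2.2.2.2.2 j j.2⟩) le_rfl
        rintro l hl m q hix ⟨⟨hL, h3, h10⟩, hq, h1, h5, h4, h5'⟩
        refine ⟨_, Run.setReal _ _ _ _ _, rfl, ⟨hL.congr rfl rfl rfl rfl, h3, h10⟩, hq, h1,
          fun j hj => ?_, h4, fun j hj => ?_⟩
        · have hjl : j.1 ≠ l := by omega
          simp [Ix.eval, hix, hjl, h5 j (by omega)]
        · by_cases hjl : j.1 = l
          · subst hjl
            simp [Ix.eval, hix, h5 j le_rfl, h4 j, Finset.sum_range_succ]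
          · simp [Ix.eval, hix, hjl, h5' j (by omega)]
      have hi : Spec O (.setReal 10 (.lit 1) (wrk 1 + .lit 1))
          (fun A q => D.At p t A ∧ q = q₀ + (k + 1) ∧ A 10 1 = k ∧
            ∀ j : Fin d, A 5 j = ∑ i ∈ Finset.range (k + 1), O (q₀ + i) p j)
          (D.Sampled O p t q₀ (k + 1)) 1 := by
        refine Spec.setReal ?_
        rintro m q ⟨⟨hl, h3, h10⟩, hq, h1, h5⟩
        exact ⟨⟨hl.congr rfl rfl rfl rfl, h3, by simpa using h10⟩, hq, by simp [h1], h5⟩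
      exact (hq.seq (ha.seq hi)).weaken (fun _ _ h => h) (fun _ _ h => h) (by omega)
    -- Comparing the integer counter with the real number `batch` yields exactly `⌈batch⌉₊` rounds,
    -- without a rounding operation.
    · rintro k hk m q hd ⟨⟨hl, -, -⟩, -, h1, -⟩
      simpa [h1, hl.2.1] using Nat.lt_ceil.1 hk
    · rintro m q hd ⟨⟨hl, -, -⟩, -, h1, -⟩
      simpa [h1, hl.2.1, size] using Nat.le_ceil D.batch
  exact (h1.seq (h2.seq h3)).weaken (fun _ _ h => h) (fun _ _ h => h) (by ring_nf; omega)

/-- The prices after a round in which the average purchase at prices `p` was `x`. -/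
noncomputable def next (p x : Fin d → ℝ) (j : Fin d) : ℝ :=
  max (D.low j) (p j - D.rate j * (D.target j - x j))

/-- New prices go to a separate array, because they are compared with the old ones. The flag is only
ever set to `1` or left alone, so at the end it records whether any good moved. -/
theorem moveProg_spec (p y : Fin d → ℝ) (t : ℝ) (q₀ : ℕ) :
    Spec O (.seq (.setReal 10 (.lit 2) (.lit 0)) (forGoods moveProg))
      (fun A q => D.At p t A ∧ q = q₀ ∧ ∀ j : Fin d, A 5 j / A 10 1 = y j)
      (fun A q => D.At p t A ∧ q = q₀ ∧ (∀ j : Fin d, A 8 j = D.next p y j) ∧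
        (0 < A 10 2 ↔ ∃ j, D.thr < (D.next p y j - p j) * (D.next p y j - p j)))
      (d * 8 + 5) := by
  have h1 : Spec O (.setReal 10 (.lit 2) (.lit 0))
      (fun A q => D.At p t A ∧ q = q₀ ∧ ∀ j : Fin d, A 5 j / A 10 1 = y j)
      (fun A q => (D.At p t A ∧ q = q₀ ∧ ∀ j : Fin d, A 5 j / A 10 1 = y j) ∧ A 10 2 = 0) 1 := by
    refine Spec.setReal ?_
    rintro m q ⟨⟨hl, h3, h10⟩, hq, h5⟩
    exact ⟨⟨⟨hl.congr rfl rfl rfl rfl, h3, by simpa using h10⟩, hq, by simpa using h5⟩, by simp⟩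
  refine (h1.seq ((Spec.forGoods (P := moveProg)
      (fun k A q => (D.At p t A ∧ q = q₀ ∧ ∀ j : Fin d, A 5 j / A 10 1 = y j) ∧
      (∀ j : Fin d, j.1 < k → A 8 j = D.next p y j) ∧
      (0 < A 10 2 ↔ ∃ j : Fin d, j.1 < k ∧
        D.thr < (D.next p y j - p j) * (D.next p y j - p j))) 5 ?_).weaken
      (fun A q h => ⟨h.1, fun j hj => absurd hj (by omega), by simp [h.2]⟩)
      (fun A q h => h) le_rfl)).weaken (fun _ _ h => h) (fun A q h => ?_) (by omega)
  swap
  · obtain ⟨⟨h, hq, -⟩, h8, h2⟩ := h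
    refine ⟨h, hq, fun j => h8 j j.2, h2.trans ⟨fun ⟨j, _, hj⟩ => ⟨j, hj⟩,
      fun ⟨j, hj⟩ => ⟨j, j.2, hj⟩⟩⟩
  rintro k hk m q hix ⟨⟨⟨hl, h3, h10⟩, hq, h5⟩, h8, h2⟩
  obtain ⟨k, rfl⟩ : ∃ k' : Fin d, k = k'.1 := ⟨⟨k, hk⟩, rfl⟩
  have hstep : Run O (.branch (.realLt (cur 3 - cur 7 * (cur 6 - cur 5 / wrk 1)) (cur 2))
      (.setReal 8 (.reg 1) (cur 2))
      (.setReal 8 (.reg 1) (cur 3 - cur 7 * (cur 6 - cur 5 / wrk 1)))) m q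
      (m.setReal 8 k (D.next p y k)) q 2 := by
    have hcmp : (Test.realLt (cur 3 - cur 7 * (cur 6 - cur 5 / wrk 1)) (cur 2)).Holds m ↔
        p k - D.rate k * (D.target k - y k) < D.low k := by
      simp [hix, h3 k, (hl.2.2.2 k).1, (hl.2.2.2 k).2.1, (hl.2.2.2 k).2.2, h5 k]
    by_cases hlt : p k - D.rate k * (D.target k - y k) < D.low k
    · have := (Run.setReal 8 (.reg 1) (cur 2) m q (O := O)).branch_true (t :=
        .realLt (cur 3 - cur 7 * (cur 6 - cur 5 / wrk 1)) (cur 2)) (Q :=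
        .setReal 8 (.reg 1) (cur 3 - cur 7 * (cur 6 - cur 5 / wrk 1))) (hcmp.2 hlt)
      convert this using 2
      · simp [Ix.eval, hix]
      · simp [hix, next, (hl.2.2.2 k).1, hlt.le]
    · have := (Run.setReal 8 (.reg 1) (cur 3 - cur 7 * (cur 6 - cur 5 / wrk 1)) m q
        (O := O)).branch_false (t :=
        .realLt (cur 3 - cur 7 * (cur 6 - cur 5 / wrk 1)) (cur 2)) (P :=
        .setReal 8 (.reg 1) (cur 2)) (fun h => hlt (hcmp.1 h))
      convert this using 2
      · simp [Ix.eval, hix]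
      · simp [hix, next, h3 k, (hl.2.2.2 k).2.1, (hl.2.2.2 k).2.2, h5 k, not_lt.1 hlt]
  have h8' : ∀ j : Fin d, j.1 < k.1 + 1 → (m.setReal 8 k (D.next p y k)).arr 8 j
      = D.next p y j := by
    intro j hj
    by_cases hjk : j = k
    · simp [hjk]
    · have : j.1 ≠ k.1 := fun h => hjk (Fin.ext h)
      simp [this, h8 j (by omega)]
  have hcmp : (Test.realLt (sca 15) ((cur 8 - cur 3) * (cur 8 - cur 3))).Holds
      (m.setReal 8 k (D.next p y k)) ↔
        D.thr < (D.next p y k - p k) * (D.next p y k - p k) := by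
    simp [hix, h3 k, hl.2.2.1]
  by_cases hlt : D.thr < (D.next p y k - p k) * (D.next p y k - p k)
  · refine ⟨_, (hstep.seq ((Run.setReal 10 (.lit 2) (.lit 1) _ _).branch_true
      (hcmp.2 hlt))).mono (by omega), rfl, ⟨⟨hl.congr rfl rfl rfl rfl, h3, h10⟩, hq, h5⟩, h8', ?_⟩
    simp only [Mem.setReal_arr, Ix.eval, Function.update_self, Expr.eval_lit]
    exact ⟨fun _ => ⟨k, by omega, hlt⟩, fun _ => by norm_num⟩
  · refine ⟨_, (hstep.seq ((Run.setReal 10 (.lit 2) (wrk 2) _ _).branch_false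
      (fun h => hlt (hcmp.1 h)))).mono (by omega), rfl,
      ⟨⟨hl.congr rfl rfl rfl rfl, h3, h10⟩, hq, h5⟩, h8', ?_⟩
    simp only [Mem.setReal_arr, Ix.eval, Function.update_self, Expr.eval_cell_lit]
    rw [Function.update_of_ne (by norm_num), h2]
    refine ⟨fun ⟨j, hj, h⟩ => ⟨j, by omega, h⟩, fun ⟨j, hj, h⟩ => ⟨j, ?_, h⟩⟩
    rcases Nat.lt_succ_iff_lt_or_eq.1 hj with hj | hj
    · exact hj
    · exact absurd (Fin.ext hj ▸ h) hlt

/-- A bound on the number of machine steps in a round. -/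
noncomputable def cost : ℕ := d * 16 + D.size * (d * 4 + 8) + 21

/-- A round without a move keeps the old prices and sets the round counter to `rounds`, which makes
the loop exit. In that case the query count no longer matters. -/
theorem roundProg_spec (t : ℕ) (hp : ∀ j, 0 ≤ D.traj O t j) :
    Spec O roundProg (fun A q => D.At (D.traj O t) t A ∧ q = t * D.size)
      (fun A q => (D.Moves O t ∧ D.At (D.traj O (t + 1)) (t + 1 : ℕ) A ∧ q = (t + 1) * D.size) ∨
        (¬ D.Moves O t ∧ D.At (D.traj O t) D.rounds A)) D.cost := by
  have h1 : Spec O sampleProg (fun A q => D.At (D.traj O t) t A ∧ q = t * D.size)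
      (fun A q => D.At (D.traj O t) t A ∧ q = (t + 1) * D.size ∧
        ∀ j : Fin d, A 5 j / A 10 1 = D.mean O t (D.traj O t) j) _ :=
    (D.sampleProg_spec O (D.traj O t) hp t (t * D.size)).weaken (fun _ _ h => h)
      (fun A q ⟨h, hq, h1, h5⟩ => ⟨h, by rw [hq]; ring, fun j => by rw [h5, h1]; rfl⟩) le_rfl
  have h2 := D.moveProg_spec O (D.traj O t) (D.mean O t (D.traj O t)) t ((t + 1) * D.size)
  have h3 : Spec O (.branch (.realLt (.lit 0) (wrk 2))
      (.seq (forGoods (.setReal 3 (.reg 1) (cur 8))) (.setReal 10 (.lit 0) (wrk 0 + .lit 1)))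
      (.setReal 10 (.lit 0) (sca 13)))
      (fun A q => D.At (D.traj O t) t A ∧ q = (t + 1) * D.size ∧
        (∀ j : Fin d, A 8 j = D.traj O (t + 1) j) ∧ (0 < A 10 2 ↔ D.Moves O t))
      (fun A q => (D.Moves O t ∧ D.At (D.traj O (t + 1)) (t + 1 : ℕ) A ∧ q = (t + 1) * D.size) ∨
        (¬ D.Moves O t ∧ D.At (D.traj O t) D.rounds A)) (d * 4 + 6) := by
    rintro m q hd ⟨⟨hl, h3, h10⟩, hq, h8, h2⟩
    by_cases hm : D.Moves O t
    · have hcopy : Spec O (.seq (forGoods (.setReal 3 (.reg 1) (cur 8)))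
          (.setReal 10 (.lit 0) (wrk 0 + .lit 1)))
          (fun A q => D.Loaded A ∧ A 10 0 = t ∧ q = (t + 1) * D.size ∧
            ∀ j : Fin d, A 8 j = D.traj O (t + 1) j)
          (fun A q => D.At (D.traj O (t + 1)) (t + 1 : ℕ) A ∧ q = (t + 1) * D.size)
          (d * (1 + 3) + 3 + 1 + 1) := by
        refine Spec.seq (C₂ := 1)
          (g := fun A q => D.At (D.traj O (t + 1)) t A ∧ q = (t + 1) * D.size)
          ((Spec.forGoods (fun k A q => (D.Loaded A ∧ A 10 0 = t ∧ q = (t + 1) * D.size ∧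
            ∀ j : Fin d, A 8 j = D.traj O (t + 1) j) ∧
            ∀ j : Fin d, j.1 < k → A 3 j = D.traj O (t + 1) j) 1 ?_).weaken
            (fun A q h => ⟨h, fun j hj => absurd hj (by omega)⟩)
            (fun A q ⟨h, h3⟩ => ⟨⟨h.1, fun j => h3 j j.2, h.2.1⟩, h.2.2.1⟩) le_rfl)
          (Spec.setReal ?_)
        · rintro k hk m q hix ⟨⟨hl, h10, hq, h8⟩, h3⟩
          refine ⟨_, Run.setReal _ _ _ _ _, rfl, ⟨hl.congr rfl rfl rfl rfl, h10, hq, h8⟩,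
            fun j hj => ?_⟩
          by_cases hjk : j.1 = k
          · simp [Ix.eval, hix, ← hjk, h8 j]
          · simp [Ix.eval, hix, hjk, h3 j (by omega)]
        · rintro m q ⟨⟨hl, h3, h10⟩, hq⟩
          exact ⟨⟨hl.congr rfl rfl rfl rfl, h3, by simp [h10]⟩, hq⟩
      obtain ⟨m', q', r, hd', h⟩ := hcopy m q hd ⟨hl, h10, hq, h8⟩
      exact ⟨m', q', (r.branch_true (by simpa using h2.2 hm)).mono (by omega), hd',
        Or.inl ⟨hm, h⟩⟩
    · refine ⟨_, q, ((Run.setReal 10 (.lit 0) (sca 13) m q).branch_false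
        (by simpa using fun h => hm (h2.1 h))).mono (by omega), hd,
        Or.inr ⟨hm, hl.congr rfl rfl rfl rfl, h3, ?_⟩⟩
      simpa [Ix.eval] using hl.1
  exact (h1.seq (h2.seq h3)).weaken (fun _ _ h => h) (fun _ _ h => h)
    (by unfold cost; omega)

theorem descentProg_spec (hp : ∀ t j, 0 ≤ D.traj O t j) :
    Spec O descentProg (fun A q => D.Loaded A ∧ (∀ j : Fin d, A 3 j = D.start j) ∧ q = 0)
      (fun A _ => ∀ j : Fin d, A 3 j = D.stopped O ⌈D.rounds⌉₊ 0 j)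
      (⌈D.rounds⌉₊ * (D.cost + 1) + 3) := by
  -- The loop may exit early, so the induction runs over the number `r` of rounds still allowed, in
  -- parallel with the recursion of `stopped`.
  have key : ∀ r t, t + r = ⌈D.rounds⌉₊ →
      Spec O (.loop (.realLt (wrk 0) (sca 13)) roundProg)
        (fun A q => D.At (D.traj O t) t A ∧ q = t * D.size)
        (fun A _ => ∀ j : Fin d, A 3 j = D.stopped O r t j) (r * (D.cost + 1) + 1) := by
    intro r
    induction r with
    | zero =>
      rintro t ht m q hd ⟨⟨hl, h3, h10⟩, -⟩
      refine ⟨m, q, (Run.loop_exit ?_).mono (by omega), hd, h3⟩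
      have : D.rounds ≤ t := by rw [← Nat.ceil_le]; omega
      simpa [h10, hl.1] using this
    | succ r ih =>
      rintro t ht m q hd ⟨⟨hl, h3, h10⟩, hq⟩
      have hgo : (Test.realLt (wrk 0) (sca 13)).Holds m := by
        have : (t : ℝ) < D.rounds := by rw [← Nat.lt_ceil]; omega
        simpa [h10, hl.1] using this
      obtain ⟨m₁, q₁, r₁, hd₁, h₁⟩ := D.roundProg_spec O t (hp t) m q hd ⟨⟨hl, h3, h10⟩, hq⟩
      rcases h₁ with ⟨hm, h₁⟩ | ⟨hm, hl₁, h₁, h10₁⟩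
      · obtain ⟨m₂, q₂, r₂, hd₂, h₂⟩ := ih (t + 1) (by omega) m₁ q₁ hd₁ h₁
        refine ⟨m₂, q₂, (Run.loop_step hgo r₁ r₂).mono (by ring_nf; omega), hd₂, ?_⟩
        rwa [stopped, if_pos hm]
      · refine ⟨m₁, q₁, (Run.loop_step hgo r₁ (Run.loop_exit ?_)).mono (by ring_nf; omega),
          hd₁, ?_⟩
        · simp [h10₁, hl₁.1]
        · rwa [stopped, if_neg hm]
  refine (Spec.seq (Spec.setReal ?_) (key ⌈D.rounds⌉₊ 0 (by omega))).weaken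
    (f := fun A q => D.Loaded A ∧ (∀ j : Fin d, A 3 j = D.start j) ∧ q = 0)
    (fun _ _ h => h) (fun _ _ h => h) (by omega)
  rintro m q ⟨hl, h3, rfl⟩
  exact ⟨⟨hl.congr rfl rfl rfl rfl, h3, by simp⟩, by simp⟩

end Descent

end PostedPricing

/-! ### The constants of the algorithm and the program that computes them. -/

namespace PostedPricing

/-- The input of the pricing program. -/
structure Input (d : ℕ) where
  α : ℝ
  δ : ℝ
  lam : ℝ
  β : ℝ
  σ : ℝ
  R : ℝ
  γ : ℝ
  s : Fin d → ℝ
  c : Fin d → ℝ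

noncomputable section

namespace Input

variable {d : ℕ} (I : Input d)

/-- The accuracy, made smaller than one. -/
def acc : ℝ := I.α / (1 + I.α)
/-- A natural number that is at least `1 / β`. -/
def pow : ℕ := ⌈1 / I.β⌉₊
/-- An upper bound for `(4 λ / acc) ^ (1 / β)`. -/
def blow : ℝ := (4 * I.lam / I.acc) ^ I.pow
/-- A natural number with `1 ≤ 2 ^ lg * δ`. -/
def lg : ℕ := ⌈Real.logb 2 (1 / I.δ)⌉₊
/-- The supply below which a good is taken off the market. -/
def room : ℝ := 1 / (1 / I.γ + 1 + d * I.blow)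
/-- A bound for the differences of the welfare of two bundles. -/
def gap : ℝ := I.lam * (1 + d * I.R) + I.R * ∑ j, I.c j
/-- The modulus of concavity, made smaller than one. -/
def modulus : ℝ := I.σ / (1 + I.σ)
/-- The part of the supply that is held back. -/
def margin : ℝ := I.acc * I.room / (4 * I.gap)
/-- The residual of the stopping rule. -/
def tol : ℝ := I.acc * I.room / (4 * (4 * I.gap + d * (I.R + 1)))
/-- The accuracy of the demand estimates. -/
def err : ℝ := I.tol / (4 * (d + 1))
/-- The number of rounds. -/
def rounds : ℝ := 8 * I.gap / (I.modulus * (I.tol * I.tol)) + 1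
/-- The batch size. -/
def batch : ℝ :=
  4 * ((I.R + 1) * (I.R + 1)) / (I.err * I.err) * (2 * d * (I.rounds + 1) + I.lg) + 1
/-- The square of the least price change that counts. -/
def thr : ℝ := I.modulus * I.tol * (I.modulus * I.tol)

/-- The descent for a given input. -/
def descent : Descent d where
  low := I.c
  -- Scarce goods get target and step size `0`, so they stay at their initial price and add nothing
  -- to the linear term of the dual. The cap `R + 1` keeps ample supplies bounded and excludes
  -- nothing, since bundles have coordinates at most `R`.
  target j := if I.s j < I.room then 0 else min (I.s j) (I.R + 1) - I.margin
  rate j := if I.s j < I.room then 0 else I.modulus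
  start j := if I.s j < I.room then I.c j + 2 * I.lam / I.s j else I.c j
  rounds := I.rounds
  batch := I.batch
  thr := I.thr

/-- The constants that the program computes, in this order. -/
def val : ℕ → ℝ
  | 0 => d
  | 1 => ∑ j, I.c j
  | 2 => I.acc
  | 3 => I.blow
  | 4 => I.pow
  | 5 => 2 ^ I.lg
  | 6 => I.lg
  | 7 => I.room
  | 8 => I.gap
  | 9 => I.modulus
  | 10 => I.margin
  | 11 => I.tol
  | 12 => I.err
  | 13 => I.rounds
  | 14 => I.batch
  | 15 => I.thr
  | _ => 0

end Input

/-- Count the goods and add up the costs. -/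
def countProg : Prog :=
  .seq (.setReal 9 (.lit 0) (.lit 0)) <| .seq (.setReal 9 (.lit 1) (.lit 0)) <|
  forGoods (.seq (.setReal 9 (.lit 0) (sca 0 + .lit 1)) (.setReal 9 (.lit 1) (sca 1 + cur 2)))

/-- Multiply by `e` until the count reaches the bound given by the test `t`. -/
def repeatProg (t : Test) (i j : ℕ) (e : Expr) : Prog :=
  .seq (.setReal 9 (.lit i) (.lit 1)) <| .seq (.setReal 9 (.lit j) (.lit 0)) <|
  .loop t (.seq (.setReal 9 (.lit i) (sca i * e)) (.setReal 9 (.lit j) (sca j + .lit 1)))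

/-- Compute the constants. -/
def constProg : Prog :=
  .seq countProg <|
  .seq (.setReal 9 (.lit 2) (par 0 / (.lit 1 + par 0))) <|
  .seq (repeatProg (.realLt (sca 4 * par 3) (.lit 1)) 3 4 (.lit 4 * par 2 / sca 2)) <|
  .seq (repeatProg (.realLt (sca 5 * par 1) (.lit 1)) 5 6 (.lit 2)) <|
  .seq (.setReal 9 (.lit 7) (.lit 1 / (.lit 1 / par 6 + .lit 1 + sca 0 * sca 3))) <|
  .seq (.setReal 9 (.lit 8) (par 2 * (.lit 1 + sca 0 * par 5) + par 5 * sca 1)) <|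
  .seq (.setReal 9 (.lit 9) (par 4 / (.lit 1 + par 4))) <|
  .seq (.setReal 9 (.lit 10) (sca 2 * sca 7 / (.lit 4 * sca 8))) <|
  .seq (.setReal 9 (.lit 11)
    (sca 2 * sca 7 / (.lit 4 * (.lit 4 * sca 8 + sca 0 * (par 5 + .lit 1))))) <|
  .seq (.setReal 9 (.lit 12) (sca 11 / (.lit 4 * (sca 0 + .lit 1)))) <|
  .seq (.setReal 9 (.lit 13) (.lit 8 * sca 8 / (sca 9 * (sca 11 * sca 11)) + .lit 1)) <|
  .seq (.setReal 9 (.lit 14) (.lit 4 * ((par 5 + .lit 1) * (par 5 + .lit 1)) / (sca 12 * sca 12) *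
    (.lit 2 * sca 0 * (sca 13 + .lit 1) + sca 6) + .lit 1))
    (.setReal 9 (.lit 15) (sca 9 * sca 11 * (sca 9 * sca 11)))

/-- Initialize the vectors of the descent. -/
def initProg : Prog :=
  forGoods <|
  .branch (.realLt (cur 1) (sca 7))
    (.seq (.setReal 3 (.reg 1) (cur 2 + .lit 2 * par 2 / cur 1)) <|
    .seq (.setReal 6 (.reg 1) (.lit 0)) (.setReal 7 (.reg 1) (.lit 0))) <|
  .seq (.setReal 3 (.reg 1) (cur 2)) <|
  .seq (.branch (.realLt (cur 1) (par 5 + .lit 1))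
    (.setReal 6 (.reg 1) (cur 1 - sca 10))
    (.setReal 6 (.reg 1) (par 5 + .lit 1 - sca 10))) (.setReal 7 (.reg 1) (sca 9))

/-- The pricing program. -/
def pricingProg : Prog := .seq constProg <| .seq initProg descentProg

namespace Input

variable {d : ℕ} (I : Input d) (O : ℕ → (Fin d → ℝ) → (Fin d → ℝ))

/-- The initial memory. -/
def mem : Mem := inputMem I.α I.δ I.lam I.β I.σ I.R I.γ I.s I.c

/-- The input is untouched and the first `n` constants have been computed. -/
def Known (n : ℕ) (A : ℕ → ℕ → ℝ) (q : ℕ) : Prop :=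
  (∀ a < 3, A a = I.mem.arr a) ∧ (∀ k < n, A 9 k = I.val k) ∧ q = 0

variable {I}

theorem Known.update {n i : ℕ} {A : ℕ → ℕ → ℝ} {q : ℕ} (h : I.Known n A q) (hi : n ≤ i) (y : ℝ) :
    I.Known n (Function.update A 9 (Function.update (A 9) i y)) q := by
  refine ⟨fun a ha => ?_, fun k hk => ?_, h.2.2⟩
  · rw [Function.update_of_ne (by omega), h.1 a ha]
  · rw [Function.update_self, Function.update_of_ne (by omega), h.2.1 k hk]

theorem Known.update_val {n : ℕ} {A : ℕ → ℕ → ℝ} {q : ℕ} (h : I.Known n A q) {y : ℝ}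
    (hy : y = I.val n) : I.Known (n + 1) (Function.update A 9 (Function.update (A 9) n y)) q := by
  refine ⟨(h.update le_rfl y).1, fun k hk => ?_, h.2.2⟩
  rcases Nat.lt_succ_iff_lt_or_eq.1 hk with hk | rfl
  · exact (h.update le_rfl y).2.1 k hk
  · simp [hy]

theorem Known.congr {n : ℕ} {A A' : ℕ → ℕ → ℝ} {q : ℕ} (h : I.Known n A q)
    (h' : ∀ a < 3, A' a = A a) (h₉ : A' 9 = A 9) : I.Known n A' q :=
  ⟨fun a ha => (h' a ha).trans (h.1 a ha), fun k hk => h₉ ▸ h.2.1 k hk, h.2.2⟩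

theorem Known.par_eval {n : ℕ} {A : ℕ → ℕ → ℝ} {q : ℕ} (h : I.Known n A q) :
    A 0 0 = I.α ∧ A 0 1 = I.δ ∧ A 0 2 = I.lam ∧ A 0 3 = I.β ∧ A 0 4 = I.σ ∧ A 0 5 = I.R ∧
      A 0 6 = I.γ := by
  rw [h.1 0 (by omega)]
  simp [mem, inputMem, padVec]

theorem Known.supply {n : ℕ} {A : ℕ → ℕ → ℝ} {q : ℕ} (h : I.Known n A q) (j : Fin d) :
    A 1 j = I.s j := by
  rw [h.1 1 (by omega)]
  simp [mem, inputMem, padVec]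

theorem Known.cost {n : ℕ} {A : ℕ → ℕ → ℝ} {q : ℕ} (h : I.Known n A q) (j : Fin d) :
    A 2 j = I.c j := by
  rw [h.1 2 (by omega)]
  simp [mem, inputMem, padVec]

variable (I)

theorem setReal_spec (n : ℕ) (e : Expr)
    (h : ∀ m q, I.Known n m.arr q → e.eval m = I.val n) :
    Spec O (.setReal 9 (.lit n) e) (I.Known n) (I.Known (n + 1)) 1 :=
  Spec.setReal fun m q hm => hm.update_val (h m q hm)

theorem countProg_spec :
    Spec O countProg (I.Known 0) (I.Known 2) (d * 6 + 7) := by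
  have h0 : Spec O (.setReal 9 (.lit 0) (.lit 0)) (I.Known 0)
      (fun A q => I.Known 0 A q ∧ A 9 0 = 0) 1 :=
    Spec.setReal fun m q hm => ⟨hm.update le_rfl _, by simp⟩
  have h1 : Spec O (.setReal 9 (.lit 1) (.lit 0)) (fun A q => I.Known 0 A q ∧ A 9 0 = 0)
      (fun A q => I.Known 0 A q ∧ A 9 0 = (0 : ℕ) ∧
        A 9 1 = ∑ j : Fin d, if j.1 < 0 then I.c j else 0) 1 :=
    Spec.setReal fun m q hm => ⟨hm.1.update (by omega) _, by simp [hm.2], by simp⟩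
  have h2 : Spec O (forGoods (.seq (.setReal 9 (.lit 0) (sca 0 + .lit 1))
      (.setReal 9 (.lit 1) (sca 1 + cur 2))))
      (fun A q => I.Known 0 A q ∧ A 9 0 = (0 : ℕ) ∧
        A 9 1 = ∑ j : Fin d, if j.1 < 0 then I.c j else 0)
      (fun A q => I.Known 0 A q ∧ A 9 0 = (d : ℕ) ∧
        A 9 1 = ∑ j : Fin d, if j.1 < d then I.c j else 0) (d * (3 + 3) + 3) := by
    refine Spec.forGoods (fun k A q => I.Known 0 A q ∧ A 9 0 = (k : ℕ) ∧
        A 9 1 = ∑ j : Fin d, if j.1 < k then I.c j else 0) 3 ?_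
    rintro k hk m q hix ⟨hm, h0, h1⟩
    refine ⟨_, (Run.setReal _ _ _ _ _).seq (Run.setReal _ _ _ _ _), rfl,
      (hm.update (by omega) _).update (by omega) _, ?_, ?_⟩
    · simp [Ix.eval, h0]
    · have hsum : ∑ j : Fin d, (if j.1 < k + 1 then I.c j else 0) =
          (∑ j : Fin d, if j.1 < k then I.c j else 0) + I.c ⟨k, hk⟩ := by
        rw [← Fintype.sum_ite_eq' (⟨k, hk⟩ : Fin d) I.c, ← Finset.sum_add_distrib]
        refine Finset.sum_congr rfl fun j _ => ?_
        by_cases h : j = ⟨k, hk⟩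
        · subst h; simp
        · have : j.1 ≠ k := fun h' => h (Fin.ext h')
          by_cases h' : j.1 < k
          · simp [h, h', show j.1 < k + 1 by omega]
          · simp [h, h', show ¬ j.1 < k + 1 by omega]
      have := hm.cost ⟨k, hk⟩
      simp only at this
      rw [hsum]
      simp [Ix.eval, hix, h1, this]
  refine (h0.seq (h1.seq h2)).weaken (fun _ _ h => h) (fun A q h => ?_) (by omega)
  refine ⟨h.1.1, fun k hk => ?_, h.1.2.2⟩
  interval_cases k
  · exact h.2.1
  · rw [h.2.2]
    simp [val]

/-- One loop serves two purposes: with a test on the count it finds `pow` and computes `blow`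
alongside; with a test on the power it finds `lg`. -/
theorem repeatProg_spec (t : Test) (n N : ℕ) (e : Expr) (x : ℝ)
    (he : ∀ m q, I.Known n m.arr q → e.eval m = x) (h₁ : I.val n = x ^ N) (h₂ : I.val (n + 1) = N)
    (hgo : ∀ k < N, ∀ m q, I.Known n m.arr q → m.arr 9 n = x ^ k →
      m.arr 9 (n + 1) = (k : ℝ) → t.Holds m)
    (hend : ∀ m q, I.Known n m.arr q → m.arr 9 n = x ^ N →
      m.arr 9 (n + 1) = (N : ℝ) → ¬ t.Holds m) :
    Spec O (repeatProg t n (n + 1) e) (I.Known n) (I.Known (n + 2)) (N * 4 + 5) := by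
  have h0 : Spec O (.setReal 9 (.lit n) (.lit 1)) (I.Known n)
      (fun A q => I.Known n A q ∧ A 9 n = x ^ 0) 1 :=
    Spec.setReal fun m q hm => ⟨hm.update le_rfl _, by simp⟩
  have h1 : Spec O (.setReal 9 (.lit (n + 1)) (.lit 0)) (fun A q => I.Known n A q ∧ A 9 n = x ^ 0)
      (fun A q => I.Known n A q ∧ A 9 n = x ^ 0 ∧ A 9 (n + 1) = (0 : ℕ)) 1 :=
    Spec.setReal fun m q hm => ⟨hm.1.update (by omega) _, by simp [hm.2], by simp⟩
  have h2 : Spec O (.loop t (.seq (.setReal 9 (.lit n) (sca n * e))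
        (.setReal 9 (.lit (n + 1)) (sca (n + 1) + .lit 1))))
      (fun A q => I.Known n A q ∧ A 9 n = x ^ 0 ∧ A 9 (n + 1) = (0 : ℕ))
      (fun A q => I.Known n A q ∧ A 9 n = x ^ N ∧ A 9 (n + 1) = (N : ℕ)) (N * (3 + 1) + 1) := by
    refine Spec.loop (fun k A q => I.Known n A q ∧ A 9 n = x ^ k ∧ A 9 (n + 1) = (k : ℕ)) N 3
      ?_ ?_ ?_
    · rintro k hk
      refine Spec.seq (C₁ := 1) (C₂ := 1)
        (g := fun A q => I.Known n A q ∧ A 9 n = x ^ (k + 1) ∧ A 9 (n + 1) = (k : ℕ))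
        (Spec.setReal ?_) (Spec.setReal ?_)
      · rintro m q ⟨hm, h, h'⟩
        exact ⟨hm.update le_rfl _, by simp [he m q hm, h, pow_succ], by simp [h']⟩
      · rintro m q ⟨hm, h, h'⟩
        exact ⟨hm.update (by omega) _, by simp [h], by simp [h']⟩
    · rintro k hk m q - ⟨hm, h, h'⟩
      exact hgo k hk m q hm h h'
    · rintro m q - ⟨hm, h, h'⟩
      exact hend m q hm h h'
  refine (h0.seq (h1.seq h2)).weaken (fun _ _ h => h) (fun A q h => ?_) (by omega)
  refine ⟨h.1.1, fun k hk => ?_, h.1.2.2⟩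
  rcases Nat.lt_succ_iff_lt_or_eq.1 hk with hk | rfl
  · rcases Nat.lt_succ_iff_lt_or_eq.1 hk with hk | rfl
    · exact h.1.2.1 k hk
    · rw [h.2.1, h₁]
  · rw [h.2.2, h₂]

/-- This and `lt_lg_iff` turn the ceilings in `pow` and `lg` into comparisons that the machine can
perform. -/
theorem lt_pow_iff (hβ : 0 < I.β) (k : ℕ) : k < I.pow ↔ k * I.β < 1 := by
  rw [pow, Nat.lt_ceil, lt_div_iff₀ hβ]

theorem lt_lg_iff (hδ : 0 < I.δ) (k : ℕ) : k < I.lg ↔ 2 ^ k * I.δ < 1 := by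
  rw [lg, Nat.lt_ceil, Real.lt_logb_iff_rpow_lt (by norm_num) (by positivity), lt_div_iff₀ hδ,
    Real.rpow_natCast]

theorem constProg_spec (hβ : 0 < I.β) (hδ : 0 < I.δ) :
    Spec O constProg (I.Known 0) (I.Known 16) (d * 6 + I.pow * 4 + I.lg * 4 + 50) := by
  unfold constProg
  refine ((I.countProg_spec O).seq <| (I.setReal_spec O 2 _ ?_).seq <|
    (I.repeatProg_spec O _ 3 I.pow _ (4 * I.lam / I.acc) ?_ rfl rfl ?_ ?_).seq <|
    (I.repeatProg_spec O _ 5 I.lg _ 2 ?_ rfl rfl ?_ ?_).seq <|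
    (I.setReal_spec O 7 _ ?_).seq <|
    (I.setReal_spec O 8 _ ?_).seq <|
    (I.setReal_spec O 9 _ ?_).seq <|
    (I.setReal_spec O 10 _ ?_).seq <|
    (I.setReal_spec O 11 _ ?_).seq <|
    (I.setReal_spec O 12 _ ?_).seq <|
    (I.setReal_spec O 13 _ ?_).seq <|
    (I.setReal_spec O 14 _ ?_).seq <|
    (I.setReal_spec O 15 _ ?_)).weaken (fun _ _ h => h) (fun _ _ h => h) (by omega)
  · intro m q h
    simp [h.par_eval, val, acc]
  · intro m q h
    simp [h.par_eval, h.2.1 2 (by norm_num), val]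
  · intro k hk m q h _ h4
    simpa [h.par_eval, h4] using (I.lt_pow_iff hβ k).1 hk
  · intro m q h _ h4
    have := mt (I.lt_pow_iff hβ I.pow).2 (lt_irrefl _)
    simpa [h.par_eval, h4] using this
  · intro m q h
    simp
  · intro k hk m q h h3 _
    simpa [h.par_eval, h3] using (I.lt_lg_iff hδ k).1 hk
  · intro m q h h3 _
    have := mt (I.lt_lg_iff hδ I.lg).2 (lt_irrefl _)
    simpa [h.par_eval, h3] using this
  · intro m q h
    simp [h.par_eval, h.2.1 0 (by norm_num), h.2.1 3 (by norm_num), val, room]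
  · intro m q h
    simp [h.par_eval, h.2.1 0 (by norm_num), h.2.1 1 (by norm_num), val, gap]
  · intro m q h
    simp [h.par_eval, val, modulus]
  · intro m q h
    simp [h.2.1 2 (by norm_num), h.2.1 7 (by norm_num), h.2.1 8 (by norm_num), val, margin]
  · intro m q h
    simp [h.par_eval, h.2.1 0 (by norm_num), h.2.1 2 (by norm_num), h.2.1 7 (by norm_num),
      h.2.1 8 (by norm_num), val, tol]
  · intro m q h
    simp [h.2.1 0 (by norm_num), h.2.1 11 (by norm_num), val, err]
  · intro m q h
    simp [h.2.1 8 (by norm_num), h.2.1 9 (by norm_num), h.2.1 11 (by norm_num), val, rounds]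
  · intro m q h
    simp [h.par_eval, h.2.1 0 (by norm_num), h.2.1 6 (by norm_num), h.2.1 12 (by norm_num),
      h.2.1 13 (by norm_num), val, batch]
  · intro m q h
    simp [h.2.1 9 (by norm_num), h.2.1 11 (by norm_num), val, thr]

theorem initProg_spec : Spec O initProg (I.Known 16)
    (fun A q => I.descent.Loaded A ∧ (∀ j : Fin d, A 3 j = I.descent.start j) ∧ q = 0)
    (d * 10 + 3) := by
  refine (Spec.forGoods (fun k A q => I.Known 16 A q ∧ ∀ j : Fin d, j.1 < k →
    A 3 j = I.descent.start j ∧ A 6 j = I.descent.target j ∧ A 7 j = I.descent.rate j)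
    7 ?_).weaken (fun A q h => ⟨h, fun j hj => absurd hj (by omega)⟩)
    (fun A q h => ⟨⟨h.1.2.1 13 (by omega), h.1.2.1 14 (by omega), h.1.2.1 15 (by omega),
      fun j => ⟨h.1.cost j, (h.2 j j.2).2⟩⟩, fun j => (h.2 j j.2).1, h.1.2.2⟩) (by omega)
  rintro k hk m q hix ⟨hm, hv⟩
  obtain ⟨k, rfl⟩ : ∃ k' : Fin d, k = k'.1 := ⟨⟨k, hk⟩, rfl⟩
  suffices H : ∃ m', Run O (.branch (.realLt (cur 1) (sca 7))
    (.seq (.setReal 3 (.reg 1) (cur 2 + .lit 2 * par 2 / cur 1)) <|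
    .seq (.setReal 6 (.reg 1) (.lit 0)) (.setReal 7 (.reg 1) (.lit 0))) <|
    .seq (.setReal 3 (.reg 1) (cur 2)) <|
    .seq (.branch (.realLt (cur 1) (par 5 + .lit 1))
      (.setReal 6 (.reg 1) (cur 1 - sca 10))
      (.setReal 6 (.reg 1) (par 5 + .lit 1 - sca 10))) (.setReal 7 (.reg 1) (sca 9))) m q m' q 7 ∧
      m' = ((m.setReal 3 k (I.descent.start k)).setReal 6 k (I.descent.target k)).setReal 7 k
        (I.descent.rate k) by
    obtain ⟨m', hr, rfl⟩ := H
    refine ⟨_, hr, rfl, hm.congr (fun a ha => ?_) rfl, fun j hj => ?_⟩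
    · simp only [Mem.setReal_arr]
      rw [Function.update_of_ne (by omega), Function.update_of_ne (by omega),
        Function.update_of_ne (by omega)]
    by_cases hjk : j = k
    · subst hjk
      simp
    · have : j.1 ≠ k.1 := fun h => hjk (Fin.ext h)
      simpa [this] using hv j (by omega)
  have hs := hm.supply k
  have hc := hm.cost k
  have hp := hm.par_eval
  have h7 : m.arr 9 7 = I.room := hm.2.1 7 (by norm_num)
  have h9 : m.arr 9 9 = I.modulus := hm.2.1 9 (by norm_num)
  have h10 : m.arr 9 10 = I.margin := hm.2.1 10 (by norm_num)
  by_cases hlt : I.s k < I.room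
  · refine ⟨_, (Run.branch_true (by simpa [hix, hs, h7] using hlt) ((Run.setReal _ _ _ _ _).seq
      ((Run.setReal _ _ _ _ _).seq (Run.setReal _ _ _ _ _)))).mono (by omega), ?_⟩
    simp [Ix.eval, hix, hs, hc, hp, descent, hlt]
  · by_cases hR : I.s k < I.R + 1
    · refine ⟨_, (Run.branch_false (by simpa [hix, hs, h7] using hlt) ((Run.setReal _ _ _ _ _).seq
        ((Run.branch_true (by simpa [hix, hs, hp] using hR)
          (Run.setReal _ _ _ _ _)).seq (Run.setReal _ _ _ _ _)))).mono (by omega), ?_⟩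
      simp [Ix.eval, hix, hs, hc, h9, h10, descent, hlt, hR.le]
    · refine ⟨_, (Run.branch_false (by simpa [hix, hs, h7] using hlt) ((Run.setReal _ _ _ _ _).seq
        ((Run.branch_false (by simpa [hix, hs, hp] using hR)
          (Run.setReal _ _ _ _ _)).seq (Run.setReal _ _ _ _ _)))).mono (by omega), ?_⟩
      simp [Ix.eval, hix, hc, hp, h9, h10, descent, hlt, not_lt.1 hR]

/-- A bound on the running time. -/
def time : ℕ :=
  d * 16 + I.pow * 4 + I.lg * 4 + ⌈I.rounds⌉₊ * (d * 16 + ⌈I.batch⌉₊ * (d * 4 + 8) + 22) + 60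

/-- The output. -/
def output : Fin d → ℝ := I.descent.stopped O ⌈I.rounds⌉₊ 0

theorem pricingProg_halts (hβ : 0 < I.β) (hδ : 0 < I.δ)
    (hp : ∀ t j, 0 ≤ I.descent.traj O t j) :
    ∃ q m, Halts O pricingProg I.mem I.time q m ∧ m.vec d outArr = I.output O ∧ q ≤ I.time := by
  obtain ⟨m, q, hr, -, h⟩ := (((I.constProg_spec O hβ hδ).seq <| (I.initProg_spec O).seq <|
    I.descent.descentProg_spec O hp).weaken (fun _ _ h => h) (fun _ _ h => h)
      (C' := I.time) (by
        have h1 : I.descent.rounds = I.rounds := rfl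
        have h2 : I.descent.size = ⌈I.batch⌉₊ := rfl
        simp only [time, Descent.cost, h1, h2, add_assoc]
        norm_num
        omega)) I.mem 0 rfl
      ⟨fun _ _ => rfl, fun k hk => by omega, rfl⟩
  exact ⟨q, m, hr.halts.1, funext h, hr.halts.2⟩

end Input

end

end PostedPricing

namespace PostedPricing

noncomputable section

/-! ## Demand and the dual function -/

namespace Market

variable {d n : ℕ} {M : Market d n} {lam β σ R : ℝ}

theorem sum_prob (M : Market d n) : ∑ i, (M.ψ i).toReal = 1 := by
  rw [← ENNReal.toReal_sum fun i _ => M.ψ.apply_ne_top i, ← tsum_fintype (L := .unconditional _),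
    M.ψ.tsum_coe, ENNReal.toReal_one]

theorem expect_mono {f g : Fin n → ℝ} (h : ∀ i, f i ≤ g i) : M.expect f ≤ M.expect g :=
  Finset.sum_le_sum fun i _ => mul_le_mul_of_nonneg_left (h i) ENNReal.toReal_nonneg

theorem expect_add (f g : Fin n → ℝ) :
    M.expect (fun i => f i + g i) = M.expect f + M.expect g := by
  simp [expect, mul_add, Finset.sum_add_distrib]

theorem expect_sub (f g : Fin n → ℝ) :
    M.expect (fun i => f i - g i) = M.expect f - M.expect g := by
  simp [expect, mul_sub, Finset.sum_sub_distrib]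

theorem expect_const (c : ℝ) : M.expect (fun _ => c) = c := by
  rw [expect, ← Finset.sum_mul, sum_prob, one_mul]

theorem expect_mul_left (c : ℝ) (f : Fin n → ℝ) :
    M.expect (fun i => c * f i) = c * M.expect f := by
  simp only [expect, Finset.mul_sum]
  exact Finset.sum_congr rfl fun i _ => by ring

theorem expect_sum {ι : Type*} (s : Finset ι) (f : ι → Fin n → ℝ) :
    M.expect (fun i => ∑ j ∈ s, f j i) = ∑ j ∈ s, M.expect (f j) := by
  simp only [expect, Finset.mul_sum]
  exact Finset.sum_comm

theorem expect_pay (p : Fin d → ℝ) (x : Fin n → Bundle d) :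
    M.expect (fun i => pay p (x i)) = ∑ j, p j * M.expect fun i => x i j := by
  simp only [pay, expect_sum, expect_mul_left]

theorem _root_.PostedPricing.pay_sub_left (p p' : Fin d → ℝ) (x : Bundle d) :
    pay (fun j => p j - p' j) x = pay p x - pay p' x := by
  simp [pay, sub_mul, Finset.sum_sub_distrib]

theorem _root_.PostedPricing.pay_comb (p : Fin d → ℝ) (a b : ℝ) (x y : Bundle d) :
    pay p (a • x + b • y) = a * pay p x + b * pay p y := by
  simp only [pay, PiLp.add_apply, PiLp.smul_apply, smul_eq_mul, Finset.mul_sum,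
    ← Finset.sum_add_distrib]
  exact Finset.sum_congr rfl fun j _ => by ring

theorem _root_.PostedPricing.pay_nonneg {p : Fin d → ℝ} {x : Bundle d} (hp : ∀ j, 0 ≤ p j)
    (hx : ∀ j, 0 ≤ x j) : 0 ≤ pay p x :=
  Finset.sum_nonneg fun j _ => mul_nonneg (hp j) (hx j)

theorem _root_.PostedPricing.continuous_pay (p : Fin d → ℝ) :
    Continuous fun x : Bundle d => pay p x := by
  unfold pay
  fun_prop

theorem Regular.coord_le (hM : M.Regular lam β σ R) {x : Bundle d} (hx : x ∈ M.F) (j : Fin d) :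
    x j ≤ R :=
  ((le_abs_self _).trans (PiLp.norm_apply_le x j)).trans (hM.bounded x hx)

theorem Regular.continuousOn (hM : M.Regular lam β σ R) (hβ : 0 < β) (i : Fin n) :
    ContinuousOn (M.v i) M.F := by
  intro x hx
  rw [ContinuousWithinAt, tendsto_iff_dist_tendsto_zero]
  have hc : Continuous fun y : Bundle d => lam * (∑ j, |y j - x j|) ^ β :=
    continuous_const.mul (Continuous.rpow_const (by fun_prop) fun _ => Or.inr hβ.le)
  have h0 := (hc.tendsto x).mono_left (nhdsWithin_le_nhds (s := M.F))
  simp only [sub_self, abs_zero, Finset.sum_const_zero, Real.zero_rpow hβ.ne', mul_zero] at h0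
  refine squeeze_zero' (Filter.Eventually.of_forall fun _ => dist_nonneg) ?_ h0
  filter_upwards [self_mem_nhdsWithin] with y hy
  rw [Real.dist_eq]
  exact hM.holder i y hy x hx

theorem Regular.isCompact (hM : M.Regular lam β σ R) : IsCompact M.F :=
  Metric.isCompact_of_isClosed_isBounded hM.closed
    (isBounded_iff_forall_norm_le.2 ⟨R, hM.bounded⟩)

/-- Compactness of `F` and continuity from the Hölder bound provide a maximizer, so the choice in
`demand` is not a junk value. -/
theorem Regular.demand_spec (hM : M.Regular lam β σ R) (hβ : 0 < β) (hne : M.F.Nonempty)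
    (i : Fin n) (p : Fin d → ℝ) : demand M.F (M.v i) p ∈ M.F ∧
      ∀ y ∈ M.F, M.v i y - pay p y
        ≤ M.v i (demand M.F (M.v i) p) - pay p (demand M.F (M.v i) p) := by
  apply Classical.epsilon_spec (p := fun x => x ∈ M.F ∧ ∀ y ∈ M.F,
    M.v i y - pay p y ≤ M.v i x - pay p x)
  obtain ⟨x, hx, h⟩ := hM.isCompact.exists_isMaxOn hne
    ((hM.continuousOn hβ i).sub (continuous_pay p).continuousOn)
  exact ⟨x, hx, fun y hy => h hy⟩

/-- The utility of a bundle falls short of the optimum by a quadratic function of the distance. -/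
theorem Regular.quadratic_growth (hM : M.Regular lam β σ R) (hβ : 0 < β) (i : Fin n)
    (p : Fin d → ℝ) {y : Bundle d} (hy : y ∈ M.F) :
    M.v i y - pay p y + σ / 2 * ‖y - demand M.F (M.v i) p‖ ^ 2
      ≤ M.v i (demand M.F (M.v i) p) - pay p (demand M.F (M.v i) p) := by
  obtain ⟨hx, hmax⟩ := hM.demand_spec hβ ⟨y, hy⟩ i p
  set x := demand M.F (M.v i) p
  set K := σ / 2 * ‖y - x‖ ^ 2 with hK
  have hK0 : 0 ≤ K := mul_nonneg (by linarith [hM.sigma_pos]) (sq_nonneg _)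
  set A := M.v i y - pay p y - (M.v i x - pay p x) with hA
  suffices h : A + K ≤ 0 by linarith
  by_contra! hpos
  -- Maximality of `x` along the segment towards `y` forces `t * (A + K - t * K) ≤ 0`. Any `t` in
  -- `(0, 1)` with `t * K < A + K` contradicts this; the explicit choice replaces a limit `t → 0`.
  set t := (A + K) / (1 + K + (A + K)) with ht
  have hden : 0 < 1 + K + (A + K) := by linarith
  have ht0 : 0 < t := div_pos hpos hden
  have ht1 : t < 1 := by rw [ht, div_lt_one hden]; linarith
  have htK : t * K < A + K := by
    rw [ht, div_mul_eq_mul_div, div_lt_iff₀ hden]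
    nlinarith
  have hc := (hM.concave i).2 hy hx ht0.le (by linarith : (0 : ℝ) ≤ 1 - t) (by ring)
  have hz := hmax _ (hM.convex hy hx ht0.le (by linarith : (0 : ℝ) ≤ 1 - t) (by ring))
  rw [pay_comb] at hz
  simp only [smul_eq_mul] at hc
  have : t * (A + K - t * K) ≤ 0 := by
    rw [← hK] at hc
    have e : t * (A + K - t * K) = t * M.v i y + (1 - t) * M.v i x + t * (1 - t) * K -
        (t * pay p y + (1 - t) * pay p x) - (M.v i x - pay p x) := by
      rw [hA]
      ring
    linarith
  nlinarith

/-- The dual function of the welfare maximization with supply `target`. -/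
def dual (M : Market d n) (target p : Fin d → ℝ) : ℝ :=
  M.expect (fun i => M.v i (demand M.F (M.v i) p) - pay p (demand M.F (M.v i) p)) +
    ∑ j, (p j - M.cost j) * target j

/-- The subtracted sum is the defect in complementary slackness. Where it is small, the dual value
is nearly attained as welfare. -/
theorem welfare_eq (M : Market d n) (target p : Fin d → ℝ) :
    M.welfare p = M.dual target p - ∑ j, (p j - M.cost j) * (target j - M.expDemand p j) := by
  have h : ∀ i, M.v i (demand M.F (M.v i) p) - pay M.cost (demand M.F (M.v i) p) =
      (M.v i (demand M.F (M.v i) p) - pay p (demand M.F (M.v i) p)) +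
        pay (fun j => p j - M.cost j) (demand M.F (M.v i) p) := by
    intro i
    rw [pay_sub_left]
    ring
  simp only [welfare, h, expect_add, expect_pay, dual, mul_sub, Finset.sum_sub_distrib, expDemand]
  ring

/-- Smoothness of the dual. The demand at `p'` is a suboptimal bundle at `p`, so quadratic growth
charges it for its distance from the demand at `p`; this charge pays for the change in payments up
to `(p' j - p j) ^ 2 / (2 * σ)` per good. -/
theorem Regular.dual_le (hM : M.Regular lam β σ R) (hβ : 0 < β) (hne : M.F.Nonempty)
    (target p p' : Fin d → ℝ) :
    M.dual target p' ≤ M.dual target p +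
      ∑ j, ((target j - M.expDemand p j) * (p' j - p j) + (p' j - p j) ^ 2 / (2 * σ)) := by
  have hσ := hM.sigma_pos
  have h : ∀ i, M.v i (demand M.F (M.v i) p') - pay p' (demand M.F (M.v i) p') ≤
      M.v i (demand M.F (M.v i) p) - pay p (demand M.F (M.v i) p) -
        pay (fun j => p' j - p j) (demand M.F (M.v i) p) + ∑ j, (p' j - p j) ^ 2 / (2 * σ) := by
    intro i
    have hq := hM.quadratic_growth hβ i p (hM.demand_spec hβ hne i p').1
    set y := demand M.F (M.v i) p'
    set x := demand M.F (M.v i) p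
    have hp : pay p' y = pay p y + pay (fun j => p' j - p j) y := by rw [pay_sub_left]; ring
    have hsum : -(σ / 2 * ‖y - x‖ ^ 2) - pay (fun j => p' j - p j) y ≤
        - pay (fun j => p' j - p j) x + ∑ j, (p' j - p j) ^ 2 / (2 * σ) := by
      rw [EuclideanSpace.real_norm_sq_eq]
      simp only [pay, Finset.mul_sum, ← Finset.sum_neg_distrib, ← Finset.sum_sub_distrib,
        ← Finset.sum_add_distrib]
      refine Finset.sum_le_sum fun j _ => ?_
      simp only [PiLp.sub_apply]
      -- Completing the square, coordinate by coordinate.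
      have : (p' j - p j) ^ 2 / (2 * σ) + σ / 2 * (y j - x j) ^ 2 + (p' j - p j) * (y j - x j)
          = (p' j - p j + σ * (y j - x j)) ^ 2 / (2 * σ) := by
        field_simp
        ring
      have h2 : 0 ≤ (p' j - p j + σ * (y j - x j)) ^ 2 / (2 * σ) := by positivity
      linarith
    linarith
  have := expect_mono (M := M) h
  simp only [expect_add, expect_sub, expect_const, expect_pay] at this
  simp only [dual, expDemand, expect_sub, expect_pay]
  have e : ∑ j, ((target j - M.expect fun i => demand M.F (M.v i) p j) * (p' j - p j) +
      (p' j - p j) ^ 2 / (2 * σ)) + ∑ j, (p j - M.cost j) * target j =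
      ∑ j, (p' j - M.cost j) * target j -
        ∑ j, (p' j - p j) * (M.expect fun i => demand M.F (M.v i) p j) +
        ∑ j, (p' j - p j) ^ 2 / (2 * σ) := by
    rw [← Finset.sum_add_distrib, ← Finset.sum_sub_distrib, ← Finset.sum_add_distrib]
    exact Finset.sum_congr rfl fun j _ => by ring
  linarith

/-- The unused-supply term is kept: for an interior bundle it bounds the markups, and for a
competing allocation within the target it is nonnegative. -/
theorem Regular.weak_duality (hM : M.Regular lam β σ R) (hβ : 0 < β) {target p : Fin d → ℝ}
    {y : Fin n → Bundle d} (hy : ∀ i, y i ∈ M.F) :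
    M.expect (fun i => M.v i (y i) - pay M.cost (y i)) +
      ∑ j, (p j - M.cost j) * (target j - M.expect fun i => y i j) ≤ M.dual target p := by
  have h : ∀ i, M.v i (y i) - pay M.cost (y i) ≤
      M.v i (demand M.F (M.v i) p) - pay p (demand M.F (M.v i) p) +
        pay (fun j => p j - M.cost j) (y i) := by
    intro i
    have := (hM.demand_spec hβ ⟨_, hy i⟩ i p).2 _ (hy i)
    rw [pay_sub_left]
    linarith
  have := expect_mono (M := M) h
  rw [expect_add, expect_pay] at this
  simp only [dual, mul_sub, Finset.sum_sub_distrib] at this ⊢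
  linarith

theorem Regular.nonneg_radius (hM : M.Regular lam β σ R) (hne : M.F.Nonempty) : 0 ≤ R := by
  obtain ⟨x, hx⟩ := hne
  exact (norm_nonneg x).trans (hM.bounded x hx)

theorem Regular.expDemand_nonneg (hM : M.Regular lam β σ R) (hβ : 0 < β) (hne : M.F.Nonempty)
    (p : Fin d → ℝ) (j : Fin d) : 0 ≤ M.expDemand p j := by
  rw [← expect_const (M := M) 0]
  exact expect_mono fun i => hM.orthant _ (hM.demand_spec hβ hne i p).1 j

theorem _root_.PostedPricing.rpow_le_one_add {t : ℝ} (ht : 0 ≤ t) (hβ : 0 < β) (hβ1 : β ≤ 1) :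
    t ^ β ≤ 1 + t := by
  rcases le_total t 1 with h | h
  · linarith [Real.rpow_le_one ht h hβ.le]
  · have := Real.rpow_le_rpow_of_exponent_le h hβ1
    rw [Real.rpow_one] at this
    linarith

/-- Values and costs of bundles vary by a bounded amount. -/
theorem Regular.value_le (hM : M.Regular lam β σ R) (hβ : 0 < β) (hβ1 : β ≤ 1) (i : Fin n)
    {x y : Bundle d} (hx : x ∈ M.F) (hy : y ∈ M.F) :
    M.v i x ≤ M.v i y - pay M.cost y + (lam * (1 + d * R) + R * ∑ j, M.cost j) := by
  have h1 := (le_abs_self _).trans (hM.holder i x hx y hy)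
  have h2 : ∑ j, |x j - y j| ≤ d * R := by
    calc ∑ j, |x j - y j| ≤ ∑ _j : Fin d, R := Finset.sum_le_sum fun j _ => by
          rw [abs_le]
          constructor <;> linarith [hM.coord_le hx j, hM.coord_le hy j, hM.orthant x hx j,
            hM.orthant y hy j]
      _ = d * R := by simp
  have h3 := rpow_le_one_add (t := ∑ j, |x j - y j|) (Finset.sum_nonneg fun _ _ => abs_nonneg _)
    hβ hβ1
  have h4 : pay M.cost y ≤ R * ∑ j, M.cost j := by
    rw [pay, Finset.mul_sum]
    exact Finset.sum_le_sum fun j _ => by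
      rw [mul_comm]
      exact mul_le_mul_of_nonneg_right (hM.coord_le hy j) (hM.cost_nonneg j)
  have h5 := mul_le_mul_of_nonneg_left (h3.trans (by linarith : _ ≤ 1 + d * R))
    (by linarith [hM.one_le_lam] : (0 : ℝ) ≤ lam)
  linarith

/-! ## Disposable goods -/

/-- The bundle `x` without the goods in `S`. -/
def _root_.PostedPricing.drop (S : Finset (Fin d)) (x : Bundle d) : Bundle d :=
  WithLp.toLp 2 fun j => if j ∈ S then 0 else x j

@[simp] theorem _root_.PostedPricing.drop_apply (S : Finset (Fin d)) (x : Bundle d) (j : Fin d) :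
    drop S x j = if j ∈ S then 0 else x j := rfl

theorem drop_mem {S : Finset (Fin d)} (hS : ∀ j ∈ S, M.Disposable j) {x : Bundle d}
    (hx : x ∈ M.F) : drop S x ∈ M.F := by
  induction S using Finset.induction_on with
  | empty =>
    convert hx
    ext j
    simp
  | insert a S ha ih =>
    refine hS a (Finset.mem_insert_self a S) _
      (ih fun j hj => hS j (Finset.mem_insert_of_mem hj)) _ (by simp) fun k hk => ?_
    simp [hk]

/-- A disposable good in supply at most `1` is not oversold at the price `2 λ / s`. -/
theorem Regular.demand_le_of_price (hM : M.Regular lam β σ R) (hβ : 0 < β) (hβ1 : β ≤ 1)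
    (hne : M.F.Nonempty) (i : Fin n) {p : Fin d → ℝ} {j : Fin d} {s : ℝ} (hj : M.Disposable j)
    (hs : 0 < s) (hs1 : s ≤ 1) (hp : 2 * lam / s ≤ p j) : demand M.F (M.v i) p j ≤ s := by
  obtain ⟨hx, hmax⟩ := hM.demand_spec hβ hne i p
  set x := demand M.F (M.v i) p
  by_contra! hlt
  have hlam : 0 < lam := by linarith [hM.one_le_lam]
  have hxj : 0 < x j := hs.trans hlt
  have hy : drop {j} x ∈ M.F := drop_mem (by simpa using hj) hx
  have h1 := hmax _ hy
  have h2 := (le_abs_self _).trans (hM.holder i x hx _ hy)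
  have h3 : ∑ k, |x k - drop {j} x k| = x j := by
    rw [Finset.sum_eq_single j]
    · simp [abs_of_pos hxj]
    · intro k _ hk
      simp [hk]
    · simp
  have h4 : pay p x - pay p (drop {j} x) = p j * x j := by
    rw [pay, pay, ← Finset.sum_sub_distrib, Finset.sum_eq_single j]
    · simp
    · intro k _ hk
      simp [hk]
    · simp
  rw [h3] at h2
  -- Beyond `s` the power lies below the line of slope `1 / s`; this uses `s ≤ 1`. Dropping the good
  -- then loses value at most `λ * x j / s` and saves at least twice that in payment.
  have h5 : x j ^ β ≤ x j / s := by
    have e : x j ^ β = x j * x j ^ (β - 1) := by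
      rw [Real.rpow_sub_one hxj.ne']
      field_simp
    rw [e, div_eq_mul_inv]
    refine mul_le_mul_of_nonneg_left ?_ hxj.le
    calc x j ^ (β - 1) ≤ s ^ (β - 1) := Real.rpow_le_rpow_of_nonpos hs hlt.le (by linarith)
      _ ≤ s ^ (-1 : ℝ) := Real.rpow_le_rpow_of_exponent_ge hs hs1 (by linarith)
      _ = s⁻¹ := Real.rpow_neg_one s
  have h6 := mul_le_mul_of_nonneg_right hp hxj.le
  have h7 : 2 * lam / s * x j = 2 * (lam * (x j / s)) := by ring
  have h8 := mul_le_mul_of_nonneg_left h5 hlam.le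
  have h9 : 0 < lam * (x j / s) := by positivity
  linarith

/-- If the slack is at least `g ≤ 1`, then every good whose supply is below `g` is disposable, and
some feasible bundle has none of these goods and leaves `g` of the others. -/
theorem Regular.exists_center (hM : M.Regular lam β σ R) {s : Fin d → ℝ} {γ g : ℝ}
    (hs : M.HasSlack s γ) (hgγ : g ≤ γ) (hg1 : g ≤ 1) :
    (∀ j, s j < g → M.Disposable j ∧ 0 < s j) ∧ ∃ x ∈ M.F, (∀ j, s j < g → x j = 0) ∧
      ∀ j, ¬ s j < g → x j + g ≤ min (s j) (R + 1) := by
  classical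
  obtain ⟨x, hx, h⟩ := hs
  have hsmall : ∀ j, s j < g → ¬ x j + γ ≤ s j := by
    intro j hj hle
    linarith [hM.orthant x hx j]
  -- All goods without additive slack are dropped, not only the scarce ones: a dropped good with
  -- supply at least `g` has coordinate `0` and so leaves room `g`.
  refine ⟨fun j hj => (h j).resolve_left (hsmall j hj),
    drop (Finset.univ.filter fun j => ¬ x j + γ ≤ s j) x, drop_mem (fun j hj => ?_) hx,
    fun j hj => by simp [not_le.1 (hsmall j hj)], fun j hj => ?_⟩
  · exact ((h j).resolve_left (by simpa using hj)).1
  · have hR := hM.nonneg_radius ⟨x, hx⟩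
    have := hM.coord_le hx j
    rw [drop_apply, le_min_iff]
    split_ifs with hmem
    · exact ⟨by linarith [not_lt.1 hj], by linarith⟩
    · have : x j + γ ≤ s j := by simpa using hmem
      exact ⟨by linarith, by linarith⟩

end Market

end

end PostedPricing

/-! ### Replacing lotteries by allocations that fit the trimmed supply. -/

namespace PostedPricing

noncomputable section

namespace Market

variable {d n : ℕ} {M : Market d n} {lam β σ R : ℝ}

theorem Regular.concaveOn (hM : M.Regular lam β σ R) (i : Fin n) : ConcaveOn ℝ M.F (M.v i) :=
  (hM.concave i).concaveOn fun r => by have := hM.sigma_pos; positivity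

/-- The mean bundles of a lottery are at least as good as the lottery. -/
theorem Regular.exists_mean (hM : M.Regular lam β σ R) (hβ : 0 < β) {s : Fin d → ℝ}
    {π : Fin n → Measure (Bundle d)} (hπ : M.IsLottery s π) :
    ∃ y : Fin n → Bundle d, (∀ i, y i ∈ M.F) ∧ (∀ j, M.expect (fun i => y i j) ≤ s j) ∧
      M.lotteryWelfare π ≤ M.expect fun i => M.v i (y i) - pay M.cost (y i) := by
  have hint : ∀ i, Integrable (fun x : Bundle d => x) (π i) := fun i =>
    have := hπ.prob i
    Integrable.of_bound aestronglyMeasurable_id R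
      ((hπ.feasible i).mono fun x hx => hM.bounded x hx)
  have hcoord : ∀ i j, Integrable (fun x : Bundle d => x j) (π i) := fun i j =>
    (EuclideanSpace.proj (𝕜 := ℝ) j).integrable_comp (hint i)
  have happ : ∀ i j, (∫ x, x ∂(π i)) j = ∫ x, x j ∂(π i) := fun i j =>
    ((EuclideanSpace.proj (𝕜 := ℝ) j).integral_comp_comm (hint i)).symm
  have hmem : ∀ i, ∫ x, x ∂(π i) ∈ M.F := fun i =>
    have := hπ.prob i
    hM.convex.integral_mem hM.closed (hπ.feasible i) (hint i)
  refine ⟨fun i => ∫ x, x ∂(π i), hmem, fun j => ?_, expect_mono fun i => ?_⟩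
  · simp only [happ]
    exact hπ.supply j
  · have := hπ.prob i
    obtain ⟨C, hC⟩ := hM.isCompact.exists_bound_of_continuousOn (hM.continuousOn hβ i)
    have hv : Integrable (M.v i) (π i) := by
      refine Integrable.of_bound ?_ C ((hπ.feasible i).mono hC)
      have := (hM.continuousOn hβ i).aestronglyMeasurable (μ := π i) hM.closed.measurableSet
      rwa [Measure.restrict_eq_self_of_ae_mem (hπ.feasible i)] at this
    have hp : Integrable (fun x => pay M.cost x) (π i) :=
      integrable_finsetSum _ fun j _ => (hcoord i j).const_mul _
    rw [integral_sub hv hp]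
    have h1 := (hM.concaveOn i).le_map_integral (hM.continuousOn hβ i) hM.closed
      (hπ.feasible i) (hint i) hv
    have h2 : ∫ x, pay M.cost x ∂(π i) = pay M.cost (∫ x, x ∂(π i)) := by
      simp only [pay]
      rw [integral_finsetSum _ fun j _ => (hcoord i j).const_mul _]
      simp only [integral_const_mul, happ]
    rw [h2]
    linarith

/-- Dropping the goods in short supply costs little welfare. -/
theorem Regular.exists_dropped (hM : M.Regular lam β σ R) (hβ : 0 < β) (hβ1 : β ≤ 1)
    {s : Fin d → ℝ} {g : ℝ} (hg : 0 < g) (hdisp : ∀ j, s j < g → M.Disposable j)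
    {y : Fin n → Bundle d} (hy : ∀ i, y i ∈ M.F) (hs : ∀ j, M.expect (fun i => y i j) ≤ s j) :
    ∃ z : Fin n → Bundle d, (∀ i, z i ∈ M.F) ∧ (∀ i j, s j < g → z i j = 0) ∧
      (∀ i j, ¬ s j < g → z i j = y i j) ∧
      M.expect (fun i => M.v i (y i) - pay M.cost (y i)) ≤
        M.expect (fun i => M.v i (z i) - pay M.cost (z i)) + lam * (d * g) ^ β := by
  classical
  set S : Finset (Fin d) := Finset.univ.filter fun j => s j < g with hS
  have hz : ∀ i, drop S (y i) ∈ M.F := fun i =>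
    drop_mem (fun j hj => hdisp j (by simpa [hS] using hj)) (hy i)
  refine ⟨fun i => drop S (y i), hz, fun i j hj => by simp [hS, hj],
    fun i j hj => by simp [hS, hj], ?_⟩
  set u : Fin n → ℝ := fun i => ∑ j, |y i j - drop S (y i) j| with hu
  have hu0 : ∀ i, 0 ≤ u i := fun i => Finset.sum_nonneg fun _ _ => abs_nonneg _
  have h1 : ∀ i, M.v i (y i) - pay M.cost (y i) ≤
      M.v i (drop S (y i)) - pay M.cost (drop S (y i)) + lam * u i ^ β := by
    intro i
    have h2 := (le_abs_self _).trans (hM.holder i _ (hy i) _ (hz i))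
    have h3 : pay M.cost (drop S (y i)) ≤ pay M.cost (y i) := by
      refine Finset.sum_le_sum fun j _ => mul_le_mul_of_nonneg_left ?_ (hM.cost_nonneg j)
      rw [drop_apply]
      split_ifs
      · exact hM.orthant _ (hy i) j
      · exact le_rfl
    linarith
  refine (expect_mono h1).trans ?_
  rw [expect_add, expect_mul_left]
  refine add_le_add_right (mul_le_mul_of_nonneg_left ?_ (by linarith [hM.one_le_lam])) _
  -- Single buyers may hold much of a scarce good; only the expectation is limited. Jensen for the
  -- concave power moves the expectation inside.
  have h4 : M.expect (fun i => u i ^ β) ≤ M.expect u ^ β := by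
    have := (Real.concaveOn_rpow hβ.le hβ1).le_map_sum (t := Finset.univ)
      (w := fun i => (M.ψ i).toReal) (p := u) (fun i _ => ENNReal.toReal_nonneg) M.sum_prob
      (fun i _ => hu0 i)
    simpa [expect] using this
  refine h4.trans (Real.rpow_le_rpow ?_ ?_ hβ.le)
  · rw [← expect_const (M := M) 0]
    exact expect_mono hu0
  · rw [hu, expect_sum]
    calc ∑ j, M.expect (fun i => |y i j - drop S (y i) j|) ≤ ∑ _j : Fin d, g := by
          refine Finset.sum_le_sum fun j _ => ?_
          by_cases hj : s j < g
          · refine le_trans (le_of_eq ?_) ((hs j).trans hj.le)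
            congr 1
            ext i
            simp [hS, hj, abs_of_nonneg (hM.orthant _ (hy i) j)]
          · simp [hS, hj, expect_const, hg.le]
      _ = d * g := by simp

/-- Moving towards a bundle in the interior of the supply costs little welfare. -/
theorem Regular.exists_mixed (hM : M.Regular lam β σ R) (hβ : 0 < β) (hβ1 : β ≤ 1)
    {x : Bundle d} (hx : x ∈ M.F) {z : Fin n → Bundle d} (hz : ∀ i, z i ∈ M.F)
    {θ : ℝ} (hθ : 0 ≤ θ) (hθ1 : θ ≤ 1) :
    ∃ y : Fin n → Bundle d, (∀ i, y i ∈ M.F) ∧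
      (∀ j, M.expect (fun i => y i j) = (1 - θ) * M.expect (fun i => z i j) + θ * x j) ∧
      M.expect (fun i => M.v i (z i) - pay M.cost (z i)) ≤
        M.expect (fun i => M.v i (y i) - pay M.cost (y i)) +
          θ * (lam * (1 + d * R) + R * ∑ j, M.cost j) := by
  have h1 : (0 : ℝ) ≤ 1 - θ := by linarith
  refine ⟨fun i => (1 - θ) • z i + θ • x, fun i => hM.convex (hz i) hx h1 hθ (by ring),
    fun j => ?_, ?_⟩
  · simp [expect_add, expect_mul_left, expect_const]
  · rw [← expect_const (M := M) (θ * _), ← expect_add]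
    refine expect_mono fun i => ?_
    have h2 := (hM.concaveOn i).2 (hz i) hx h1 hθ (by ring)
    have h3 := hM.value_le hβ hβ1 i (hz i) hx
    have h4 : 0 ≤ pay M.cost (z i) := pay_nonneg hM.cost_nonneg (hM.orthant _ (hz i))
    rw [pay_comb]
    simp only [smul_eq_mul] at h2
    nlinarith

end Market

/-! ### Numerical relations between the constants. -/

namespace Input

variable {d : ℕ} {I : Input d}

/-- The bounds on the input that are guaranteed. -/
structure Valid (I : Input d) : Prop where
  α_pos : 0 < I.α
  δ_pos : 0 < I.δ
  δ_lt : I.δ < 1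
  one_le_lam : 1 ≤ I.lam
  β_pos : 0 < I.β
  β_le : I.β ≤ 1
  σ_pos : 0 < I.σ
  R_nonneg : 0 ≤ I.R
  γ_pos : 0 < I.γ
  c_nonneg : ∀ j, 0 ≤ I.c j

namespace Valid

theorem acc_pos (h : I.Valid) : 0 < I.acc := div_pos h.α_pos (by linarith [h.α_pos])

theorem acc_lt_one (h : I.Valid) : I.acc < 1 := by
  rw [acc, div_lt_one] <;> linarith [h.α_pos]

theorem acc_le (h : I.Valid) : I.acc ≤ I.α :=
  div_le_self h.α_pos.le (by linarith [h.α_pos])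

theorem blow_pos (h : I.Valid) : 0 < I.blow :=
  pow_pos (div_pos (by linarith [h.one_le_lam]) h.acc_pos) _

theorem room_den (h : I.Valid) : 0 < 1 / I.γ + 1 + d * I.blow := by
  have := h.blow_pos
  have := h.γ_pos
  positivity

theorem room_pos (h : I.Valid) : 0 < I.room := one_div_pos.2 h.room_den

theorem room_mul (h : I.Valid) : I.room * (1 / I.γ + 1 + d * I.blow) = 1 :=
  one_div_mul_cancel h.room_den.ne'

theorem room_le_one (h : I.Valid) : I.room ≤ 1 := by
  rw [room, div_le_one h.room_den]
  have := h.blow_pos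
  have := h.γ_pos
  have : 0 < 1 / I.γ := by positivity
  have : 0 ≤ d * I.blow := by positivity
  linarith

theorem room_le (h : I.Valid) : I.room ≤ I.γ := by
  have := h.blow_pos
  have := h.γ_pos
  rw [room, div_le_iff₀ h.room_den, mul_add, mul_add, mul_one_div_cancel this.ne']
  have : 0 ≤ I.γ * (d * I.blow) := by positivity
  linarith

/-- With `r = acc / (4 λ) ≤ 1`, `blow` is `r ^ (-pow)`, so the definition of `room` gives `d * room
≤ r ^ pow`; then `pow * β ≥ 1` suffices. -/
theorem loss_le (h : I.Valid) : I.lam * (d * I.room) ^ I.β ≤ I.acc / 4 := by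
  have ha := h.acc_pos
  have hl : 0 < I.lam := by linarith [h.one_le_lam]
  set r := I.acc / (4 * I.lam) with hr
  have hr0 : 0 < r := by positivity
  have hr1 : r ≤ 1 := by
    rw [hr, div_le_one (by positivity)]
    linarith [h.acc_lt_one, h.one_le_lam]
  have hb : I.blow * r ^ I.pow = 1 := by
    rw [blow, ← mul_pow, hr, div_mul_div_cancel₀ ha.ne', div_self (by positivity), one_pow]
  have h1 : d * I.room * I.blow ≤ 1 := by
    have hm := h.room_mul
    have h2 : 0 < I.room * (1 / I.γ + 1) := by
      have := h.room_pos
      have := h.γ_pos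
      positivity
    nlinarith
  have h2 : d * I.room ≤ r ^ I.pow := by
    have := mul_le_mul_of_nonneg_right h1 (pow_pos hr0 I.pow).le
    rwa [mul_assoc, hb, mul_one, one_mul] at this
  have h3 : (d * I.room) ^ I.β ≤ r := by
    have hroom := h.room_pos
    calc (d * I.room) ^ I.β ≤ (r ^ I.pow) ^ I.β := Real.rpow_le_rpow (by positivity) h2 h.β_pos.le
      _ = r ^ (I.pow * I.β) := by rw [← Real.rpow_natCast, ← Real.rpow_mul hr0.le]
      _ ≤ r ^ (1 : ℝ) := Real.rpow_le_rpow_of_exponent_ge hr0 hr1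
          (not_lt.1 (mt (I.lt_pow_iff h.β_pos I.pow).2 (lt_irrefl _)))
      _ = r := Real.rpow_one r
  calc I.lam * (d * I.room) ^ I.β ≤ I.lam * r := mul_le_mul_of_nonneg_left h3 hl.le
    _ = I.acc / 4 := by rw [hr]; field_simp

theorem one_le_gap (h : I.Valid) : 1 ≤ I.gap := by
  have h1 := h.one_le_lam
  have h2 : 0 ≤ (d : ℝ) * I.R := mul_nonneg (Nat.cast_nonneg d) h.R_nonneg
  have h3 : 0 ≤ I.R * ∑ j, I.c j :=
    mul_nonneg h.R_nonneg (Finset.sum_nonneg fun j _ => h.c_nonneg j)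
  unfold gap
  nlinarith

theorem modulus_pos (h : I.Valid) : 0 < I.modulus := div_pos h.σ_pos (by linarith [h.σ_pos])

theorem modulus_le_one (h : I.Valid) : I.modulus ≤ 1 := by
  rw [modulus, div_le_one] <;> linarith [h.σ_pos]

theorem modulus_le (h : I.Valid) : I.modulus ≤ I.σ :=
  div_le_self h.σ_pos.le (by linarith [h.σ_pos])

theorem tol_den (h : I.Valid) : 0 < 4 * I.gap + d * (I.R + 1) := by
  have := h.one_le_gap
  have := h.R_nonneg
  positivity

theorem tol_pos (h : I.Valid) : 0 < I.tol :=
  div_pos (mul_pos h.acc_pos h.room_pos) (mul_pos (by norm_num) h.tol_den)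

theorem tol_mul (h : I.Valid) : I.tol * (4 * I.gap + d * (I.R + 1)) = I.acc * I.room / 4 := by
  have := h.tol_den.ne'
  rw [tol]
  field_simp

theorem margin_mul (h : I.Valid) : I.margin * I.gap = I.acc * I.room / 4 := by
  have : I.gap ≠ 0 := by linarith [h.one_le_gap]
  rw [margin]
  field_simp

/-- The reserve covers the stopping tolerance and the sampling error together. -/
theorem two_tol_le (h : I.Valid) : 2 * I.tol ≤ I.margin := by
  have h1 := h.tol_mul
  have h2 := h.margin_mul
  have h3 := h.tol_pos
  have h4 := h.one_le_gap
  have h5 : 0 ≤ I.tol * (d * (I.R + 1)) := by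
    have := h.R_nonneg
    positivity
  have : 0 < I.tol * I.gap := by positivity
  have : 2 * I.tol * I.gap ≤ I.margin * I.gap := by linarith
  exact le_of_mul_le_mul_right this (by linarith)

theorem err_pos (h : I.Valid) : 0 < I.err := div_pos h.tol_pos (by positivity)

theorem err_mul (I : Input d) : I.err * (4 * (d + 1)) = I.tol := by
  have : (4 : ℝ) * (d + 1) ≠ 0 := by positivity
  rw [err, div_mul_cancel₀ _ this]

theorem err_le (h : I.Valid) : I.err ≤ I.tol :=
  div_le_self h.tol_pos.le (by
    have : (0 : ℝ) ≤ d := Nat.cast_nonneg d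
    linarith)

/-- Summed over all goods, the sampling noise takes at most a quarter of the progress `modulus * tol
^ 2 / 4` of a moving round. -/
theorem err_sq (h : I.Valid) : d * I.err ^ 2 ≤ I.tol ^ 2 / 16 := by
  have h1 := err_mul I
  have h2 := h.err_pos
  rw [← h1]
  have : (0 : ℝ) ≤ d := Nat.cast_nonneg d
  have : 0 ≤ I.err ^ 2 * (d ^ 2 + d + 1) := by positivity
  nlinarith

/-- If all `rounds` rounds made the guaranteed progress, the dual would fall by more than it can. -/
theorem gap_lt (h : I.Valid) : I.gap < I.rounds * (I.modulus * I.tol ^ 2 / 8) := by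
  have h1 := h.modulus_pos
  have h2 := h.tol_pos
  have : I.rounds * (I.modulus * I.tol ^ 2 / 8) = I.gap + I.modulus * I.tol ^ 2 / 8 := by
    rw [rounds]
    field_simp
  rw [this]
  have : 0 < I.modulus * I.tol ^ 2 / 8 := by positivity
  linarith

end Valid

end Input

end

end PostedPricing

/-! ### Convergence of the descent and quality of its output. -/

namespace PostedPricing

noncomputable section

namespace Input

variable {d n : ℕ} {I : Input d} {M : Market d n} {O : ℕ → (Fin d → ℝ) → (Fin d → ℝ)}

/-- The part of the markups that the descent controls. -/
def markup (I : Input d) (p : Fin d → ℝ) : ℝ := ∑ j, if I.s j < I.room then 0 else p j - I.c j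

theorem Valid.margin_le (h : I.Valid) : I.margin ≤ I.room / 2 := by
  have h1 := h.margin_mul
  have h2 := h.one_le_gap
  have h3 := h.room_pos
  have h4 := h.acc_lt_one
  have h5 : 0 < I.margin := by linarith [h.two_tol_le, h.tol_pos]
  nlinarith

theorem traj_of_small {j : Fin d} (h : I.Valid) (hj : I.s j < I.room) (hs : 0 < I.s j) (t : ℕ) :
    I.descent.traj O t j = I.c j + 2 * I.lam / I.s j := by
  have h1 : 0 ≤ 2 * I.lam / I.s j := by
    have := h.one_le_lam
    positivity
  induction t with
  | zero => simp [Descent.traj, descent, hj]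
  | succ t ih =>
    simp only [Descent.traj, ih]
    simp [descent, hj, h1]

theorem low_le_traj (h : I.Valid) (hs : ∀ j, I.s j < I.room → 0 < I.s j) (t : ℕ) (j : Fin d) :
    I.c j ≤ I.descent.traj O t j := by
  cases t with
  | succ t => exact le_max_left _ _
  | zero =>
    simp only [Descent.traj, descent]
    split_ifs with hj
    · have := hs j hj
      have := h.one_le_lam
      have : 0 ≤ 2 * I.lam / I.s j := by positivity
      linarith
    · exact le_rfl

/-- Projection gives `Δ * (Δ + m * (r - xhat)) ≤ 0`, so the estimated gradient contributes `-Δ ^ 2 /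
m`. Smoothness returns half of this, and Young's inequality for the estimation error another
quarter. -/
theorem descent_step_le {c p r x xhat m e : ℝ} (hm : 0 < m) (hcp : c ≤ p)
    (hx : |xhat - x| ≤ e) {Δ : ℝ} (hΔ : Δ = max c (p - m * (r - xhat)) - p) :
    (r - x) * Δ + Δ ^ 2 / (2 * m) ≤ -(Δ ^ 2 / (4 * m)) + m * e ^ 2 := by
  have h1 : Δ * (Δ + m * (r - xhat)) ≤ 0 := by
    rcases le_total c (p - m * (r - xhat)) with h | h
    · rw [max_eq_right h] at hΔ
      rw [hΔ]
      ring_nf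
      exact le_rfl
    · rw [max_eq_left h] at hΔ
      refine mul_nonpos_of_nonpos_of_nonneg (by linarith) (by linarith)
  have h2 : (xhat - x) * Δ ≤ e * |Δ| :=
    (le_abs_self _).trans (by rw [abs_mul]; exact mul_le_mul_of_nonneg_right hx (abs_nonneg _))
  have h3 : (r - xhat) * Δ ≤ -(Δ ^ 2 / m) := by
    rw [le_neg, div_le_iff₀ hm]
    linarith
  have h4 : e * |Δ| ≤ Δ ^ 2 / (4 * m) + m * e ^ 2 := by
    have : Δ ^ 2 / (4 * m) + m * e ^ 2 - e * |Δ| = (|Δ| - 2 * m * e) ^ 2 / (4 * m) := by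
      field_simp
      rw [← sq_abs Δ]
      ring
    have h5 : 0 ≤ (|Δ| - 2 * m * e) ^ 2 / (4 * m) := by positivity
    linarith
  have e1 : Δ ^ 2 / m = 4 * (Δ ^ 2 / (4 * m)) := by field_simp
  have e2 : Δ ^ 2 / (2 * m) = 2 * (Δ ^ 2 / (4 * m)) := by field_simp; ring
  linarith [show (r - x) * Δ = (r - xhat) * Δ + (xhat - x) * Δ by ring]

section Good

variable (hM : M.Regular I.lam I.β I.σ I.R) (h : I.Valid) (hc : ∀ j, I.c j = M.cost j)
  (hne : M.F.Nonempty) (hpos : ∀ j, I.s j < I.room → 0 < I.s j)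
include hM h hc hne hpos

omit hc in
theorem dual_succ_le {t : ℕ} (hacc : ∀ j, |I.descent.mean O t (I.descent.traj O t) j -
    M.expDemand (I.descent.traj O t) j| ≤ I.err) (hmove : I.descent.Moves O t) :
    M.dual I.descent.target (I.descent.traj O (t + 1)) + I.modulus * I.tol ^ 2 / 8 ≤
      M.dual I.descent.target (I.descent.traj O t) := by
  have hm := h.modulus_pos
  set p := I.descent.traj O t with hp
  set p' := I.descent.traj O (t + 1) with hp'
  have h1 := hM.dual_le h.β_pos hne I.descent.target p p'
  have h2 : ∀ j, (I.descent.target j - M.expDemand p j) * (p' j - p j) +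
      (p' j - p j) ^ 2 / (2 * I.σ) ≤
      -((p' j - p j) ^ 2 / (4 * I.modulus)) + I.modulus * I.err ^ 2 := by
    intro j
    by_cases hj : I.s j < I.room
    · have : p' j = p j := by
        rw [hp, hp', traj_of_small h hj (hpos j hj), traj_of_small h hj (hpos j hj)]
      rw [this]
      simp only [sub_self]
      have : 0 ≤ I.modulus * I.err ^ 2 := by positivity
      simpa using this
    · have hΔ : p' j - p j = max (I.c j)
          (p j - I.modulus * (I.descent.target j - I.descent.mean O t p j)) - p j := by
        rw [hp', Descent.traj]
        simp [descent, hj, hp]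
      refine le_trans ?_ (descent_step_le hm (low_le_traj h hpos t j) (hacc j) hΔ)
      -- The step size is at most `σ`, so the smoothness term is covered.
      have : (p' j - p j) ^ 2 / (2 * I.σ) ≤ (p' j - p j) ^ 2 / (2 * I.modulus) :=
        div_le_div_of_nonneg_left (sq_nonneg _) (by positivity) (by linarith [h.modulus_le])
      linarith
  have h3 := Finset.sum_le_sum fun j (_ : j ∈ Finset.univ) => h2 j
  rw [Finset.sum_add_distrib (f := fun j => -((p' j - p j) ^ 2 / (4 * I.modulus))),
    Finset.sum_neg_distrib] at h3
  simp only [Finset.sum_const, Finset.card_univ, Fintype.card_fin, nsmul_eq_mul] at h3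
  obtain ⟨j, hj⟩ := hmove
  have h4 : I.modulus * I.tol ^ 2 / 4 ≤ ∑ j, (p' j - p j) ^ 2 / (4 * I.modulus) := by
    refine le_trans ?_ (Finset.single_le_sum (f := fun j => (p' j - p j) ^ 2 / (4 * I.modulus))
      (fun j _ => by positivity) (Finset.mem_univ j))
    rw [le_div_iff₀ (by positivity)]
    have : I.descent.thr = I.modulus * I.tol * (I.modulus * I.tol) := rfl
    rw [this] at hj
    simp only [← hp, ← hp'] at hj
    nlinarith
  have h5 := mul_le_mul_of_nonneg_left h.err_sq hm.le
  have h6 : 0 ≤ I.modulus * I.tol ^ 2 := by positivity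
  linarith

omit hne hpos in
-- The bundle `x` leaves at least `room - margin ≥ room / 2` of each controlled target unused, so
-- every unit of markup adds `room / 2` in weak duality.
theorem le_dual {x : Bundle d} (hx : x ∈ M.F) (hx0 : ∀ j, I.s j < I.room → x j = 0)
    (hxg : ∀ j, ¬ I.s j < I.room → x j + I.room ≤ min (I.s j) (I.R + 1)) {p : Fin d → ℝ}
    (hp : ∀ j, I.c j ≤ p j) :
    M.expect (fun i => M.v i x - pay M.cost x) + I.room / 2 * I.markup p
      ≤ M.dual I.descent.target p := by
  refine le_trans (add_le_add_right ?_ _) (hM.weak_duality h.β_pos (target := I.descent.target)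
    (p := p) (y := fun _ => x) fun _ => hx)
  rw [markup, Finset.mul_sum]
  refine Finset.sum_le_sum fun j _ => ?_
  rw [Market.expect_const, ← hc j]
  by_cases hj : I.s j < I.room
  · simp [descent, hj, hx0 j hj]
  · simp only [hj, if_false]
    rw [mul_comm]
    refine mul_le_mul_of_nonneg_left ?_ (by linarith [hp j])
    have : I.descent.target j = min (I.s j) (I.R + 1) - I.margin := by simp [descent, hj]
    linarith [hxg j hj, h.margin_le]

/-- At the start each good has price equal to cost or target `0`, so the linear term vanishes and
only expected utility remains. -/
theorem dual_start_le {x : Bundle d} (hx : x ∈ M.F) :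
    M.dual I.descent.target I.descent.start ≤
      M.expect (fun i => M.v i x - pay M.cost x) + I.gap := by
  have h0 : ∑ j, (I.descent.start j - M.cost j) * I.descent.target j = 0 := by
    refine Finset.sum_eq_zero fun j _ => ?_
    by_cases hj : I.s j < I.room <;> simp [descent, hj, hc j]
  rw [Market.dual, h0, add_zero, ← Market.expect_const (M := M) I.gap, ← Market.expect_add]
  refine Market.expect_mono fun i => ?_
  have hy := (hM.demand_spec h.β_pos hne i I.descent.start).1
  have h1 := hM.value_le h.β_pos h.β_le i hy hx
  have h2 : 0 ≤ pay I.descent.start (demand M.F (M.v i) I.descent.start) :=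
    -- The oracle here is a dummy: the initial prices do not depend on it.
    pay_nonneg (fun j => (h.c_nonneg j).trans (low_le_traj (O := fun _ => id) h hpos 0 j))
      (hM.orthant _ hy)
  have h3 : I.gap = I.lam * (1 + d * I.R) + I.R * ∑ j, M.cost j := by
    rw [gap]
    simp only [hc]
  linarith

/-- With accurate estimates, the descent stops in time, at moderate prices. -/
theorem exists_stopped {x : Bundle d} (hx : x ∈ M.F) (hx0 : ∀ j, I.s j < I.room → x j = 0)
    (hxg : ∀ j, ¬ I.s j < I.room → x j + I.room ≤ min (I.s j) (I.R + 1))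
    (hacc : ∀ t < ⌈I.rounds⌉₊, ∀ j, |I.descent.mean O t (I.descent.traj O t) j -
      M.expDemand (I.descent.traj O t) j| ≤ I.err) :
    ∃ u < ⌈I.rounds⌉₊, I.output O = I.descent.traj O u ∧ ¬ I.descent.Moves O u ∧
      I.room * I.markup (I.descent.traj O u) ≤ 2 * I.gap := by
  obtain ⟨u, -, hu, hout, hmoves, hend⟩ := I.descent.stopped_eq O ⌈I.rounds⌉₊ 0
  rw [zero_add] at hu hend
  have hdec : ∀ v ≤ u, M.dual I.descent.target (I.descent.traj O v) +
      v * (I.modulus * I.tol ^ 2 / 8) ≤ M.dual I.descent.target I.descent.start := by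
    intro v
    induction v with
    | zero => intro _; simp [Descent.traj]
    | succ v ih =>
      intro hv
      have h1 := ih (by omega)
      have h2 := dual_succ_le hM h hne hpos (hacc v (by omega))
        (hmoves v (Nat.zero_le v) (by omega))
      push_cast
      linarith
  have h1 := hdec u le_rfl
  have h2 := le_dual hM h hc hx hx0 hxg (low_le_traj (O := O) h hpos u)
  have h3 := dual_start_le hM h hc hne hpos hx
  have h4 : 0 ≤ I.markup (I.descent.traj O u) := Finset.sum_nonneg fun j _ => by
    split_ifs
    · exact le_rfl
    · linarith [low_le_traj (O := O) h hpos u j]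
  have hm := h.modulus_pos
  have ht := h.tol_pos
  have hr := h.room_pos
  have h5 : 0 ≤ I.room / 2 * I.markup (I.descent.traj O u) := by positivity
  have h6 : 0 ≤ u * (I.modulus * I.tol ^ 2 / 8) := by positivity
  -- The strict inequality matters: it shows that the stopping rule, not the round limit, ended the
  -- descent.
  have hlt : u < ⌈I.rounds⌉₊ := by
    rw [Nat.lt_ceil]
    by_contra! hle
    have := mul_le_mul_of_nonneg_right hle (by positivity : 0 ≤ I.modulus * I.tol ^ 2 / 8)
    linarith [h.gap_lt]
  exact ⟨u, hlt, hout, hend hlt, by linarith⟩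

omit hc hpos in
/-- Stationary prices almost satisfy the constraints and complementary slackness. -/
theorem stationary {t : ℕ} (hacc : ∀ j, |I.descent.mean O t (I.descent.traj O t) j -
      M.expDemand (I.descent.traj O t) j| ≤ I.err) (hend : ¬ I.descent.Moves O t)
    {j : Fin d} (hj : ¬ I.s j < I.room) (hlow : I.c j ≤ I.descent.traj O t j) :
    M.expDemand (I.descent.traj O t) j ≤ I.s j ∧
      (I.descent.traj O t j - I.c j) *
        (I.descent.target j - M.expDemand (I.descent.traj O t) j) ≤
        (I.descent.traj O t j - I.c j) * (2 * I.tol) + I.tol * (I.R + 1) := by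
  have hm := h.modulus_pos
  have hm1 := h.modulus_le_one
  have ht := h.tol_pos
  have htarget : I.descent.target j = min (I.s j) (I.R + 1) - I.margin := by simp [descent, hj]
  have hmin1 := min_le_left (I.s j) (I.R + 1)
  have hmin2 := min_le_right (I.s j) (I.R + 1)
  have he := abs_le.1 (hacc j)
  have herr := h.err_le
  have h2 := h.two_tol_le
  have hx0 := hM.expDemand_nonneg h.β_pos hne (I.descent.traj O t) j
  have hR := h.R_nonneg
  have hΔ : |I.descent.traj O (t + 1) j - I.descent.traj O t j| ≤ I.modulus * I.tol := by
    refine abs_le_of_sq_le_sq ?_ (by positivity)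
    have := not_lt.1 (fun hlt => hend ⟨j, hlt⟩)
    rw [sq, sq]
    exact this
  have hΔ' : I.descent.traj O (t + 1) j = max (I.c j) (I.descent.traj O t j -
      I.modulus * (I.descent.target j - I.descent.mean O t (I.descent.traj O t) j)) := by
    rw [Descent.traj]
    simp [descent, hj]
  rw [abs_le] at hΔ
  set p := I.descent.traj O t
  set g := I.descent.target j - I.descent.mean O t p j with hg
  -- Projection onto `p ≥ c` never limits an increase, so demand well above the target would have
  -- moved the price.
  have h3 : -I.tol ≤ g := by
    have := le_max_right (I.c j) (p j - I.modulus * g)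
    have : I.modulus * (-I.tol) ≤ I.modulus * g := by linarith
    exact le_of_mul_le_mul_left this hm
  refine ⟨by linarith, ?_⟩
  have hp0 : 0 ≤ p j - I.c j := by linarith
  rcases le_or_gt g I.tol with hgt | hgt
  · have : (p j - I.c j) * (I.descent.target j - M.expDemand p j) ≤
        (p j - I.c j) * (2 * I.tol) := mul_le_mul_of_nonneg_left (by linarith) hp0
    have : 0 ≤ I.tol * (I.R + 1) := by positivity
    linarith
  -- With `g > tol` an unprojected step would be a move. Hence the price was cut off at the cost,
  -- and the markup is at most `modulus * tol ≤ tol`.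
  · have h4 : p j - I.c j ≤ I.tol := by
      have h5 := mul_lt_mul_of_pos_left hgt hm
      rcases max_choice (I.c j) (p j - I.modulus * g) with h6 | h6
      · have : I.modulus * I.tol ≤ 1 * I.tol := mul_le_mul_of_nonneg_right hm1 ht.le
        linarith
      · linarith
    have h7 : I.descent.target j - M.expDemand p j ≤ I.R + 1 := by linarith
    have h8 : (p j - I.c j) * (I.descent.target j - M.expDemand p j) ≤
        (p j - I.c j) * (I.R + 1) := mul_le_mul_of_nonneg_left h7 hp0
    have h9 : (p j - I.c j) * (I.R + 1) ≤ I.tol * (I.R + 1) :=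
      mul_le_mul_of_nonneg_right h4 (by linarith)
    have : 0 ≤ (p j - I.c j) * (2 * I.tol) := by positivity
    linarith

end Good

/-- With accurate estimates, the output is feasible and almost optimal. -/
theorem output_good (hM : M.Regular I.lam I.β I.σ I.R) (h : I.Valid)
    (hc : ∀ j, I.c j = M.cost j) (hs : M.HasSlack I.s I.γ)
    (hacc : ∀ t < ⌈I.rounds⌉₊, ∀ j, |I.descent.mean O t (I.descent.traj O t) j -
      M.expDemand (I.descent.traj O t) j| ≤ I.err) :
    (∀ j, M.expDemand (I.output O) j ≤ I.s j) ∧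
      M.welfare (I.output O) ≥ M.optLottery I.s - I.α := by
  obtain ⟨hsmall, x, hx, hx0, hxg⟩ := hM.exists_center hs h.room_le h.room_le_one
  have hne : M.F.Nonempty := ⟨x, hx⟩
  have hpos : ∀ j, I.s j < I.room → 0 < I.s j := fun j hj => (hsmall j hj).2
  obtain ⟨u, hu, hout, hend, hmark⟩ := exists_stopped hM h hc hne hpos hx hx0 hxg hacc
  rw [hout]
  have hlow := low_le_traj (O := O) h hpos u
  have hsta := fun j hj => stationary hM h hne (hacc u hu) hend (j := j) hj (hlow j)
  have hsmallp := fun j hj => traj_of_small (O := O) h hj (hpos j hj) u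
  set p := I.descent.traj O u
  have hroom := h.room_pos
  have ha := h.acc_pos
  have ht := h.tol_pos
  have hgap := h.one_le_gap
  refine ⟨fun j => ?_, ?_⟩
  · by_cases hj : I.s j < I.room
    · rw [← Market.expect_const (M := M) (I.s j)]
      refine Market.expect_mono fun i => hM.demand_le_of_price h.β_pos h.β_le hne i (hsmall j hj).1
        (hpos j hj) (hj.le.trans h.room_le_one) ?_
      rw [hsmallp j hj]
      linarith [h.c_nonneg j]
    · exact (hsta j hj).1
  have hslack : ∑ j, (p j - M.cost j) * (I.descent.target j - M.expDemand p j) ≤ I.acc / 4 := by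
    calc ∑ j, (p j - M.cost j) * (I.descent.target j - M.expDemand p j)
        ≤ ∑ j, ((if I.s j < I.room then 0 else p j - I.c j) * (2 * I.tol) +
            I.tol * (I.R + 1)) := by
          refine Finset.sum_le_sum fun j _ => ?_
          rw [← hc j]
          by_cases hj : I.s j < I.room
          -- A scarce good has target `0`, so its sales make the term nonpositive however high the
          -- markup.
          · have h1 : I.descent.target j = 0 := by simp [descent, hj]
            have h2 := mul_nonneg (sub_nonneg.2 (hlow j)) (hM.expDemand_nonneg h.β_pos hne p j)
            have h3 : 0 ≤ I.tol * (I.R + 1) := mul_nonneg ht.le (by linarith [h.R_nonneg])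
            rw [h1, if_pos hj]
            linarith
          · rw [if_neg hj]
            exact (hsta j hj).2
      _ = I.markup p * (2 * I.tol) + d * (I.tol * (I.R + 1)) := by
          rw [Finset.sum_add_distrib, ← Finset.sum_mul]
          simp [markup]
      _ ≤ I.acc / 4 := by
          have h1 := h.tol_mul
          have h2 := mul_le_mul_of_nonneg_right hmark (by linarith : 0 ≤ 2 * I.tol)
          have h3 : I.room * (d * (I.tol * (I.R + 1))) ≤ 1 * (d * (I.tol * (I.R + 1))) :=
            mul_le_mul_of_nonneg_right h.room_le_one (by have := h.R_nonneg; positivity)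
          have h4 : I.room * (I.markup p * (2 * I.tol) + d * (I.tol * (I.R + 1))) ≤
              I.room * (I.acc / 4) := by linarith
          exact le_of_mul_le_mul_left h4 hroom
  have hgapeq : I.gap = I.lam * (1 + d * I.R) + I.R * ∑ j, M.cost j := by
    rw [gap]
    simp only [hc]
  suffices hopt : M.optLottery I.s ≤ M.welfare p + I.α by linarith
  have hxs : ∀ j, x j ≤ I.s j := by
    intro j
    by_cases hj : I.s j < I.room
    · rw [hx0 j hj]
      exact (hpos j hj).le
    · linarith [hxg j hj, min_le_left (I.s j) (I.R + 1)]
  -- The point mass at the interior bundle is a lottery, so the supremum is over a nonempty set.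
  refine csSup_le ⟨_, fun _ => Measure.dirac x, ⟨fun _ => inferInstance, fun _ => ?_, fun j => ?_⟩,
    rfl⟩ ?_
  · exact (ae_dirac_iff (p := (· ∈ M.F)) hM.closed.measurableSet).2 hx
  · rw [integral_dirac, Market.expect_const]
    exact hxs j
  rintro _ ⟨π, hπ, rfl⟩
  obtain ⟨y, hy, hys, hyw⟩ := hM.exists_mean h.β_pos hπ
  obtain ⟨z, hz, hz0, hzy, hzw⟩ := hM.exists_dropped h.β_pos h.β_le hroom
    (fun j hj => (hsmall j hj).1) hy hys
  -- Chosen so that moving by `θ` towards `x` costs `acc / 4` and frees `θ * room = margin` of every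
  -- controlled good.
  set θ := I.acc / (4 * I.gap) with hθ
  have hθ0 : 0 ≤ θ := by positivity
  have hθ1 : θ ≤ 1 := by
    rw [hθ, div_le_one (by positivity)]
    linarith [h.acc_lt_one]
  have hθg : θ * I.gap = I.acc / 4 := by
    rw [hθ]
    field_simp
  have hθr : θ * I.room = I.margin := by
    rw [hθ, margin]
    ring
  obtain ⟨w, hw, hws, hww⟩ := hM.exists_mixed h.β_pos h.β_le hx hz hθ0 hθ1
  have hweak := hM.weak_duality h.β_pos (target := I.descent.target) (p := p) hw
  have hnn : 0 ≤ ∑ j, (p j - M.cost j) * (I.descent.target j - M.expect fun i => w i j) := by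
    refine Finset.sum_nonneg fun j _ => mul_nonneg (by rw [← hc j]; linarith [hlow j]) ?_
    rw [hws j]
    by_cases hj : I.s j < I.room
    · have : I.descent.target j = 0 := by simp [descent, hj]
      simp [this, hz0 _ j hj, hx0 j hj, Market.expect_const]
    · have h1 : I.descent.target j = min (I.s j) (I.R + 1) - I.margin := by simp [descent, hj]
      have h2 : M.expect (fun i => z i j) ≤ min (I.s j) (I.R + 1) := by
        simp only [hzy _ j hj]
        refine le_min (hys j) ?_
        rw [← Market.expect_const (M := M) (I.R + 1)]
        exact Market.expect_mono fun i => by linarith [hM.coord_le (hy i) j]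
      have h3 := mul_le_mul_of_nonneg_left h2 (by linarith : 0 ≤ 1 - θ)
      have h4 := mul_le_mul_of_nonneg_left (hxg j hj) hθ0
      rw [h1]
      linarith
  have hwel := M.welfare_eq I.descent.target p
  have hloss := h.loss_le
  rw [← hgapeq, hθg] at hww
  linarith [h.acc_le]

end Input

end

end PostedPricing

namespace PostedPricing

noncomputable section

/-! ## Concentration for adaptively chosen queries -/

open ProbabilityTheory ENNReal

/-- `f` depends only on the first `m` entries of its argument. -/
def DependsOnFirst {n : ℕ} {γ : Type*} (m : ℕ) (f : (ℕ → Fin n) → γ) : Prop :=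
  ∀ ω ω', (∀ k < m, ω k = ω' k) → f ω = f ω'

namespace DependsOnFirst

variable {n m : ℕ} {γ : Type*}

/-- The factor lives on a finite space, which makes measurability automatic and exposes independence
from later draws. -/
theorem exists_comp [Nonempty γ] {f : (ℕ → Fin n) → γ} (h : DependsOnFirst m f) :
    ∃ g : (Finset.range m → Fin n) → γ, f = fun ω => g fun i => ω i := by
  have hf : Function.FactorsThrough f fun ω (i : Finset.range m) => ω i := fun ω ω' hω =>
    h ω ω' fun k hk => congrFun hω ⟨k, Finset.mem_range.2 hk⟩
  exact ⟨_, ((Function.factorsThrough_iff f).1 hf).choose_spec⟩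

theorem measurable {f : (ℕ → Fin n) → ℝ≥0∞} (h : DependsOnFirst m f) : Measurable f := by
  obtain ⟨g, rfl⟩ := h.exists_comp
  exact (measurable_of_finite g).comp (by fun_prop)

end DependsOnFirst

namespace Market

variable {d n : ℕ} (M : Market d n)

instance : IsProbabilityMeasure M.buyers := by
  unfold buyers
  infer_instance

theorem lintegral_mul_indicator {m : ℕ} {G : (ℕ → Fin n) → ℝ≥0∞} (hG : DependsOnFirst m G)
    (i : Fin n) :
    ∫⁻ ω, G ω * (if ω m = i then 1 else 0) ∂M.buyers = (∫⁻ ω, G ω ∂M.buyers) * M.ψ i := by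
  obtain ⟨g, rfl⟩ := hG.exists_comp
  set e : (Fin n) → ℝ≥0∞ := fun k => if k = i then 1 else 0
  have hind : iIndepFun (fun (k : ℕ) (ω : ℕ → Fin n) => ω k) M.buyers :=
    iIndepFun_infinitePi (P := fun _ : ℕ => M.ψ.toMeasure) (X := fun _ x => x)
      fun _ => measurable_id
  have h2 := hind.indepFun_finset (Finset.range m) {m} (by simp) fun k => measurable_pi_apply k
  have h3 : IndepFun (fun ω : ℕ → Fin n => g fun i => ω i) (fun ω => e (ω m)) M.buyers :=
    h2.comp (φ := g) (ψ := fun x : ({m} : Finset ℕ) → Fin n =>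
      e (x ⟨m, Finset.mem_singleton_self m⟩)) (measurable_of_finite _) (measurable_of_finite _)
  have h4 := lintegral_mul_eq_lintegral_mul_lintegral_of_indepFun''
    ((measurable_of_finite g).comp (by fun_prop)).aemeasurable
    ((measurable_of_finite e).comp (measurable_pi_apply m)).aemeasurable h3
  refine h4.trans ?_
  congr 1
  have h5 := (measurePreserving_eval_infinitePi (fun _ : ℕ => M.ψ.toMeasure) m).lintegral_comp
    (measurable_of_finite e)
  refine Eq.trans h5 ?_
  have : e = Set.indicator {i} 1 := by
    ext k
    simp [e, Set.indicator_apply]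
  rw [this, lintegral_indicator_one (measurableSet_singleton i),
    PMF.toMeasure_apply_singleton _ _ (measurableSet_singleton i)]

/-- Conditioning on the past by hand: splitting over the value of the next draw, independent of the
first `m`, replaces it by its average. -/
theorem lintegral_next {m : ℕ} {φ : (ℕ → Fin n) → Fin n → ℝ≥0∞}
    (hφ : ∀ i, DependsOnFirst m fun ω => φ ω i) :
    ∫⁻ ω, φ ω (ω m) ∂M.buyers = ∫⁻ ω, ∑ i, M.ψ i * φ ω i ∂M.buyers := by
  have h1 : ∀ ω : ℕ → Fin n, φ ω (ω m) = ∑ i, φ ω i * (if ω m = i then 1 else 0) := by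
    intro ω
    simp
  simp only [h1]
  rw [lintegral_finsetSum, lintegral_finsetSum]
  · refine Finset.sum_congr rfl fun i _ => ?_
    rw [M.lintegral_mul_indicator (hφ i), lintegral_const_mul _ (hφ i).measurable, mul_comm]
  · exact fun i _ => (hφ i).measurable.const_mul _
  · exact fun i _ => (hφ i).measurable.mul
      ((measurable_of_finite fun k : Fin n => if k = i then (1 : ℝ≥0∞) else 0).comp
        (measurable_pi_apply m))

/-- Use `exp y ≤ 1 + y + y ^ 2` for `|y| ≤ 1`: the linear term has mean zero, and `1 + x ≤ exp x`.
-/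
theorem sum_exp_le {ξ : Fin n → ℝ} {r l : ℝ} (hξ : ∀ i, |ξ i| ≤ r) (h0 : M.expect ξ = 0)
    (hl : 0 ≤ l) (hlr : l * r ≤ 1) :
    ∑ i, M.ψ i * ENNReal.ofReal (Real.exp (l * ξ i)) ≤ ENNReal.ofReal (Real.exp ((l * r) ^ 2)) := by
  have h1 : ∀ i, Real.exp (l * ξ i) ≤ 1 + l * ξ i + (l * r) ^ 2 := by
    intro i
    have ha : |l * ξ i| ≤ l * r := by
      rw [abs_mul, abs_of_nonneg hl]
      exact mul_le_mul_of_nonneg_left (hξ i) hl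
    have hb := (le_abs_self _).trans (Real.abs_exp_sub_one_sub_id_le (ha.trans hlr))
    have hc : (l * ξ i) ^ 2 ≤ (l * r) ^ 2 := by
      rw [← sq_abs]
      exact pow_le_pow_left₀ (abs_nonneg _) ha 2
    linarith
  have h2 := expect_mono (M := M) h1
  rw [expect_add, expect_add, expect_const, expect_const, expect_mul_left, h0] at h2
  have h3 : M.expect (fun i => Real.exp (l * ξ i)) ≤ Real.exp ((l * r) ^ 2) := by
    linarith [Real.add_one_le_exp ((l * r) ^ 2)]
  refine le_trans (le_of_eq ?_) (ENNReal.ofReal_le_ofReal h3)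
  rw [expect, ENNReal.ofReal_sum_of_nonneg fun i _ => by positivity]
  refine Finset.sum_congr rfl fun i _ => ?_
  rw [ENNReal.ofReal_mul ENNReal.toReal_nonneg, ENNReal.ofReal_toReal (M.ψ.apply_ne_top i)]

/-- The moment generating function of a sum of bounded martingale differences. -/
theorem lintegral_exp_le {m : ℕ} {ξ : ℕ → (ℕ → Fin n) → Fin n → ℝ} {r l : ℝ}
    (hdep : ∀ k i, DependsOnFirst (m + k) fun ω => ξ k ω i) (hξ : ∀ k ω i, |ξ k ω i| ≤ r)
    (h0 : ∀ k ω, M.expect (ξ k ω) = 0) (hl : 0 ≤ l) (hlr : l * r ≤ 1) (N : ℕ) :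
    ∫⁻ ω, ENNReal.ofReal (Real.exp (l * ∑ k ∈ Finset.range N, ξ k ω (ω (m + k)))) ∂M.buyers ≤
      ENNReal.ofReal (Real.exp (N * (l * r) ^ 2)) := by
  induction N with
  | zero => simp
  | succ N ih =>
    have hG : DependsOnFirst (m + N) fun ω : ℕ → Fin n =>
        ENNReal.ofReal (Real.exp (l * ∑ k ∈ Finset.range N, ξ k ω (ω (m + k)))) := by
      intro ω ω' h
      have : ∀ k ∈ Finset.range N, ξ k ω (ω (m + k)) = ξ k ω' (ω' (m + k)) := by
        intro k hk
        have hk := Finset.mem_range.1 hk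
        rw [h (m + k) (by omega)]
        exact hdep k _ ω ω' fun j hj => h j (by omega)
      simp only [Finset.sum_congr rfl this]
    set G := fun ω : ℕ → Fin n =>
        ENNReal.ofReal (Real.exp (l * ∑ k ∈ Finset.range N, ξ k ω (ω (m + k)))) with hGdef
    have h1 : ∀ ω : ℕ → Fin n, ENNReal.ofReal (Real.exp (l * ∑ k ∈ Finset.range (N + 1),
        ξ k ω (ω (m + k)))) = G ω * ENNReal.ofReal (Real.exp (l * ξ N ω (ω (m + N)))) := by
      intro ω
      rw [Finset.sum_range_succ, mul_add, Real.exp_add, ENNReal.ofReal_mul (Real.exp_pos _).le]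
    simp only [h1]
    rw [M.lintegral_next (m := m + N)
      (φ := fun ω i => G ω * ENNReal.ofReal (Real.exp (l * ξ N ω i))) ?_]
    · calc ∫⁻ ω, ∑ i, M.ψ i * (G ω * ENNReal.ofReal (Real.exp (l * ξ N ω i))) ∂M.buyers
          ≤ ∫⁻ ω, G ω * ENNReal.ofReal (Real.exp ((l * r) ^ 2)) ∂M.buyers := by
            refine lintegral_mono fun ω => ?_
            simp only [mul_left_comm (M.ψ _) (G ω)]
            rw [← Finset.mul_sum]
            gcongr
            exact M.sum_exp_le (hξ N ω) (h0 N ω) hl hlr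
        _ ≤ ENNReal.ofReal (Real.exp (N * (l * r) ^ 2)) *
            ENNReal.ofReal (Real.exp ((l * r) ^ 2)) := by
            rw [lintegral_mul_const _ hG.measurable]
            gcongr
        _ = ENNReal.ofReal (Real.exp ((N + 1 : ℕ) * (l * r) ^ 2)) := by
            rw [← ENNReal.ofReal_mul (Real.exp_pos _).le, ← Real.exp_add]
            push_cast
            ring_nf
    · intro i ω ω' h
      have e1 := hG ω ω' h
      have e2 := hdep N i ω ω' h
      simp only at e1 e2
      simp only [e1, e2]

/-- Chernoff's bound with the optimal `l = ε / (2 * r ^ 2)`; the condition `ε ≤ 2 * r` keeps `l * r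
≤ 1`. -/
theorem measure_sum_gt_le {m : ℕ} {ξ : ℕ → (ℕ → Fin n) → Fin n → ℝ} {r ε : ℝ}
    (hdep : ∀ k i, DependsOnFirst (m + k) fun ω => ξ k ω i) (hξ : ∀ k ω i, |ξ k ω i| ≤ r)
    (h0 : ∀ k ω, M.expect (ξ k ω) = 0) (hr : 0 < r) (hε : 0 < ε) (hεr : ε ≤ 2 * r) (N : ℕ) :
    M.buyers {ω | N * ε < ∑ k ∈ Finset.range N, ξ k ω (ω (m + k))} ≤
      ENNReal.ofReal (Real.exp (-(N * (ε ^ 2 / (4 * r ^ 2))))) := by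
  set l := ε / (2 * r ^ 2) with hl
  have hl0 : 0 < l := by positivity
  have hlr : l * r ≤ 1 := by
    rw [hl, div_mul_eq_mul_div, div_le_one (by positivity)]
    nlinarith
  have h1 := M.lintegral_exp_le hdep hξ h0 hl0.le hlr N
  set f := fun ω : ℕ → Fin n =>
    ENNReal.ofReal (Real.exp (l * ∑ k ∈ Finset.range N, ξ k ω (ω (m + k)))) with hf
  have hdepf : DependsOnFirst (m + N) f := by
    intro ω ω' h
    have : ∀ k ∈ Finset.range N, ξ k ω (ω (m + k)) = ξ k ω' (ω' (m + k)) := by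
      intro k hk
      have hk := Finset.mem_range.1 hk
      rw [h (m + k) (by omega)]
      exact hdep k _ ω ω' fun j hj => h j (by omega)
    simp only [hf, Finset.sum_congr rfl this]
  have hexp : ENNReal.ofReal (Real.exp (l * (N * ε))) ≠ 0 := by
    simp [Real.exp_pos]
  calc M.buyers {ω | N * ε < ∑ k ∈ Finset.range N, ξ k ω (ω (m + k))}
      ≤ M.buyers {ω | ENNReal.ofReal (Real.exp (l * (N * ε))) ≤ f ω} := by
        refine measure_mono fun ω hω => ENNReal.ofReal_le_ofReal (Real.exp_le_exp.2 ?_)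
        exact mul_le_mul_of_nonneg_left (le_of_lt hω) hl0.le
    _ ≤ (∫⁻ ω, f ω ∂M.buyers) / ENNReal.ofReal (Real.exp (l * (N * ε))) :=
        meas_ge_le_lintegral_div hdepf.measurable.aemeasurable hexp ENNReal.ofReal_ne_top
    _ ≤ ENNReal.ofReal (Real.exp (N * (l * r) ^ 2)) /
        ENNReal.ofReal (Real.exp (l * (N * ε))) := by gcongr
    _ = ENNReal.ofReal (Real.exp (-(N * (ε ^ 2 / (4 * r ^ 2))))) := by
        rw [← ENNReal.ofReal_div_of_pos (Real.exp_pos _), ← Real.exp_sub]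
        congr 2
        rw [hl]
        field_simp
        ring

end Market

namespace Descent

variable {d n : ℕ} (D : Descent d) (M : Market d n)

/-- This is what makes adaptive pricing harmless: the prices of round `t` are fixed before its batch
is drawn. -/
theorem traj_congr {ω ω' : ℕ → Fin n} (t : ℕ) (h : ∀ k < t * D.size, ω k = ω' k) :
    D.traj (M.rep ω) t = D.traj (M.rep ω') t := by
  induction t with
  | zero => rfl
  | succ t ih =>
    have e := ih fun k hk => h k (by rw [Nat.succ_mul]; omega)
    have hmean : D.mean (M.rep ω) t (D.traj (M.rep ω') t) =
        D.mean (M.rep ω') t (D.traj (M.rep ω') t) := by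
      ext j
      unfold mean
      congr 1
      refine Finset.sum_congr rfl fun i hi => ?_
      have := Finset.mem_range.1 hi
      simp only [Market.rep]
      rw [h _ (by rw [Nat.succ_mul]; omega)]
    simp only [traj, e, hmean]

/-- A batch gives an accurate estimate of the expected demand. -/
theorem measure_mean_le {lam β σ R ε : ℝ} (hM : M.Regular lam β σ R) (hβ : 0 < β)
    (hne : M.F.Nonempty) (hε : 0 < ε) (hε1 : ε ≤ 1) (hsize : 0 < D.size) (t : ℕ) (j : Fin d) :
    M.buyers {ω | ε < |D.mean (M.rep ω) t (D.traj (M.rep ω) t) j -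
      M.expDemand (D.traj (M.rep ω) t) j|} ≤
      2 * ENNReal.ofReal (Real.exp (-(D.size * (ε ^ 2 / (4 * (R + 1) ^ 2))))) := by
  have hR := hM.nonneg_radius hne
  have hN : (0 : ℝ) < D.size := Nat.cast_pos.2 hsize
  set x : (ℕ → Fin n) → Fin n → ℝ := fun ω i =>
    demand M.F (M.v i) (D.traj (M.rep ω) t) j with hx
  set ξ : (ℕ → Fin n) → Fin n → ℝ := fun ω i => x ω i - M.expDemand (D.traj (M.rep ω) t) j with hξ
  have hx0 : ∀ ω i, 0 ≤ x ω i ∧ x ω i ≤ R := fun ω i =>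
    have h := (hM.demand_spec hβ hne i (D.traj (M.rep ω) t)).1
    ⟨hM.orthant _ h j, hM.coord_le h j⟩
  have hexp : ∀ ω, 0 ≤ M.expDemand (D.traj (M.rep ω) t) j ∧
      M.expDemand (D.traj (M.rep ω) t) j ≤ R := fun ω => by
    refine ⟨hM.expDemand_nonneg hβ hne _ j, ?_⟩
    rw [← Market.expect_const (M := M) R]
    exact Market.expect_mono fun i => (hx0 ω i).2
  -- The bound `R + 1` instead of `R` stays positive when `R = 0`.
  have hb : ∀ ω i, |ξ ω i| ≤ R + 1 := fun ω i => by
    rw [abs_le]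
    constructor <;> simp only [hξ] <;> linarith [hx0 ω i, hexp ω]
  have h0 : ∀ ω, M.expect (ξ ω) = 0 := fun ω => by
    simp only [hξ]
    rw [Market.expect_sub, Market.expect_const]
    exact sub_self _
  have hdep : ∀ (k : ℕ) (i : Fin n), DependsOnFirst (t * D.size + k) fun ω => ξ ω i := by
    intro k i ω ω' h
    have := D.traj_congr M t fun k hk => h k (by omega)
    simp only [hξ, hx, this]
  have h1 := M.measure_sum_gt_le (ξ := fun _ => ξ) (ε := ε) hdep (fun _ => hb) (fun _ => h0)
    (by linarith) hε (by linarith) D.size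
  have h2 := M.measure_sum_gt_le (ξ := fun _ ω i => -ξ ω i) (ε := ε)
    (fun k i ω ω' h => congrArg Neg.neg (hdep k i ω ω' h))
    (fun _ ω i => by rw [abs_neg]; exact hb ω i)
    (fun _ ω => by
      have := Market.expect_mul_left (M := M) (-1) (ξ ω)
      simpa [h0 ω] using this) (by linarith) hε (by linarith) D.size
  rw [two_mul]
  refine le_trans (le_trans (measure_mono ?_) (measure_union_le _ _)) (add_le_add h1 h2)
  intro ω hω
  have e : D.mean (M.rep ω) t (D.traj (M.rep ω) t) j - M.expDemand (D.traj (M.rep ω) t) j =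
      (∑ k ∈ Finset.range D.size, ξ ω (ω (t * D.size + k))) / D.size := by
    simp only [hξ, Finset.sum_sub_distrib, Finset.sum_const, Finset.card_range, nsmul_eq_mul]
    rw [sub_div, mul_div_cancel_left₀ _ hN.ne']
    rfl
  rw [Set.mem_ofPred_eq, e, lt_abs, ← neg_div, lt_div_iff₀ hN, lt_div_iff₀ hN] at hω
  rw [Set.mem_union, Set.mem_ofPred_eq, Set.mem_ofPred_eq, Finset.sum_neg_distrib, mul_comm]
  exact hω

end Descent

namespace Input

variable {d n : ℕ} {I : Input d} {M : Market d n}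

theorem Valid.rounds_pos (h : I.Valid) : 0 < I.rounds := by
  have := h.modulus_pos
  have := h.tol_pos
  have := h.one_le_gap
  unfold rounds
  positivity

theorem Valid.size_pos (h : I.Valid) : 0 < I.descent.size := by
  have h1 := h.R_nonneg
  have h2 := h.err_pos
  have h3 := h.rounds_pos
  refine Nat.ceil_pos.2 ?_
  change 0 < I.batch
  unfold batch
  positivity

/-- The batch size makes the exponent at least `A + lg`. The factor `exp (-A)` cancels the union
bound over both signs, all goods and all rounds, and `exp (-lg) ≤ 2 ^ (-lg) ≤ δ`. -/
theorem Valid.failure_le (h : I.Valid) :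
    2 * d * ⌈I.rounds⌉₊ * Real.exp (-(I.descent.size * (I.err ^ 2 / (4 * (I.R + 1) ^ 2)))) ≤
      I.δ := by
  have hR := h.R_nonneg
  have he := h.err_pos
  have hr := h.rounds_pos
  set A : ℝ := 2 * d * (I.rounds + 1) with hA
  have hA0 : 0 ≤ A := by positivity
  have h1 : 2 * d * ⌈I.rounds⌉₊ ≤ A :=
    mul_le_mul_of_nonneg_left (Nat.ceil_lt_add_one hr.le).le (by positivity)
  have h2 : A + I.lg ≤ I.descent.size * (I.err ^ 2 / (4 * (I.R + 1) ^ 2)) := by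
    have h3 : I.batch ≤ I.descent.size := Nat.le_ceil _
    have h4 : (I.batch - 1) * (I.err ^ 2 / (4 * (I.R + 1) ^ 2)) = A + I.lg := by
      rw [batch]
      field_simp
      ring
    rw [← h4]
    exact mul_le_mul_of_nonneg_right (by linarith) (by positivity)
  have h5 : Real.exp (-(I.descent.size * (I.err ^ 2 / (4 * (I.R + 1) ^ 2)))) ≤
      Real.exp (-A) * Real.exp (-I.lg) := by
    rw [← Real.exp_add]
    exact Real.exp_le_exp.2 (by linarith)
  have h6 : A * Real.exp (-A) ≤ 1 := by
    rw [Real.exp_neg, ← div_eq_mul_inv, div_le_one (Real.exp_pos _)]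
    linarith [Real.add_one_le_exp A]
  have h7 : Real.exp (-I.lg) ≤ I.δ := by
    have h8 := not_lt.1 (mt (I.lt_lg_iff h.δ_pos I.lg).2 (lt_irrefl _))
    have h9 : (2 : ℝ) ^ I.lg ≤ Real.exp I.lg := by
      rw [← Real.exp_one_pow]
      exact pow_le_pow_left₀ (by norm_num) (by linarith [Real.add_one_le_exp (1 : ℝ)]) _
    rw [Real.exp_neg, inv_le_iff_one_le_mul₀ (Real.exp_pos _), mul_comm]
    exact h8.trans (mul_le_mul_of_nonneg_right h9 h.δ_pos.le)
  calc _ ≤ A * (Real.exp (-A) * Real.exp (-I.lg)) := by gcongr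
    _ = A * Real.exp (-A) * Real.exp (-I.lg) := by ring
    _ ≤ 1 * I.δ := by gcongr
    _ = I.δ := one_mul _

theorem measure_accurate (hM : M.Regular I.lam I.β I.σ I.R) (h : I.Valid) (hne : M.F.Nonempty) :
    ENNReal.ofReal (1 - I.δ) ≤ M.buyers {ω | ∀ t < ⌈I.rounds⌉₊, ∀ j,
      |I.descent.mean (M.rep ω) t (I.descent.traj (M.rep ω) t) j -
        M.expDemand (I.descent.traj (M.rep ω) t) j| ≤ I.err} := by
  set good := {ω | ∀ t < ⌈I.rounds⌉₊, ∀ j,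
      |I.descent.mean (M.rep ω) t (I.descent.traj (M.rep ω) t) j -
        M.expDemand (I.descent.traj (M.rep ω) t) j| ≤ I.err} with hgood
  have herr1 : I.err ≤ 1 := by
    have h1 := h.err_le
    have h2 := h.two_tol_le
    have h3 : I.margin ≤ I.room / 2 := h.margin_le
    linarith [h.room_le_one, h.tol_pos]
  have hbad : M.buyers goodᶜ ≤ ENNReal.ofReal I.δ := by
    have hsub : goodᶜ ⊆ ⋃ t ∈ Finset.range ⌈I.rounds⌉₊, ⋃ j ∈ (Finset.univ : Finset (Fin d)),
        {ω | I.err < |I.descent.mean (M.rep ω) t (I.descent.traj (M.rep ω) t) j -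
          M.expDemand (I.descent.traj (M.rep ω) t) j|} := by
      intro ω hω
      simp only [hgood, Set.mem_compl_iff, Set.mem_ofPred_eq, not_forall, not_le] at hω
      obtain ⟨t, ht, j, hj⟩ := hω
      simp only [Set.mem_iUnion]
      exact ⟨t, Finset.mem_range.2 ht, j, Finset.mem_univ j, hj⟩
    refine (measure_mono hsub).trans ((measure_biUnion_finset_le _ _).trans ?_)
    refine (Finset.sum_le_sum fun t _ => (measure_biUnion_finset_le _ _).trans
      (Finset.sum_le_sum fun j _ => I.descent.measure_mean_le M hM h.β_pos hne h.err_pos herr1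
        h.size_pos t j)).trans ?_
    refine le_trans (le_of_eq ?_) (ENNReal.ofReal_le_ofReal h.failure_le)
    simp only [Finset.sum_const, Finset.card_univ, Fintype.card_fin, Finset.card_range,
      nsmul_eq_mul]
    rw [ENNReal.ofReal_mul (by positivity), ENNReal.ofReal_mul (by positivity),
      ENNReal.ofReal_mul (by positivity), ENNReal.ofReal_natCast, ENNReal.ofReal_natCast,
      ENNReal.ofReal_ofNat]
    ring
  rw [ENNReal.ofReal_sub _ h.δ_pos.le, ENNReal.ofReal_one, tsub_le_iff_right]
  -- Subadditivity suffices, so the event need not be shown measurable.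
  calc 1 = M.buyers (good ∪ goodᶜ) := by rw [Set.union_compl_self, measure_univ]
    _ ≤ M.buyers good + M.buyers goodᶜ := measure_union_le _ _
    _ ≤ M.buyers good + ENNReal.ofReal I.δ := by gcongr

end Input

end

end PostedPricing

namespace PostedPricing

noncomputable section

/-! ## The running time -/

namespace Input

variable {d : ℕ} {I : Input d}

/-- The parameter in which the running time is polynomial, if `C` is the norm of the costs. -/
def complexity (I : Input d) (C : ℝ) : ℝ :=
  d + 1 / I.α + 1 / I.σ + I.lam + Real.log (1 / I.δ) + I.R + C + 1 / I.γ

/-- Changing the base costs `1 / log 2 ≤ 2`, rounding up costs `1`. -/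
theorem Valid.lg_le (h : I.Valid) : (I.lg : ℝ) ≤ 2 * Real.log (1 / I.δ) + 1 := by
  have h1 : 1 < 1 / I.δ := (one_lt_div h.δ_pos).2 h.δ_lt
  have h2 : 0 < Real.log (1 / I.δ) := Real.log_pos h1
  have h3 : 0 ≤ Real.logb 2 (1 / I.δ) := Real.logb_nonneg (by norm_num) h1.le
  have h4 : Real.logb 2 (1 / I.δ) ≤ 2 * Real.log (1 / I.δ) := by
    rw [Real.logb, div_le_iff₀ (Real.log_pos (by norm_num))]
    nlinarith [Real.log_two_gt_d9]
  exact (Nat.ceil_lt_add_one h3).le.trans (by linarith)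

/-- The running time is polynomial in the parameters other than `β` and the inverse of the supply
threshold. -/
theorem Valid.time_le_of_room (h : I.Valid) {U : ℝ} (hU : 1 ≤ U) (hd : (d : ℝ) ≤ U)
    (hα : 1 / I.α ≤ U) (hσ : 1 / I.σ ≤ U) (hlam : I.lam ≤ U) (hlg : (I.lg : ℝ) ≤ 3 * U)
    (hR : I.R ≤ U) (hc : ∑ j, I.c j ≤ U ^ 2) (hroom : 1 / I.room ≤ U) :
    (I.time : ℝ) ≤ (4 * I.pow + 10 ^ 21) * U ^ 44 := by
  have hU0 : 0 < U := by linarith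
  have hR0 := h.R_nonneg
  have hpow : ∀ {a b : ℕ}, a ≤ b → U ^ a ≤ U ^ b := fun hab => pow_le_pow_right₀ hU hab
  have hone : ∀ a : ℕ, 1 ≤ U ^ a := fun a => one_le_pow₀ hU
  have hlam0 : 0 ≤ I.lam := by linarith [h.one_le_lam]
  have hgap : I.gap ≤ 3 * U ^ 3 := by
    calc I.gap ≤ U * (1 + U * U) + U * U ^ 2 := by
          unfold gap
          gcongr
          exact Finset.sum_nonneg fun j _ => h.c_nonneg j
      _ = U ^ 1 + 2 * U ^ 3 := by ring
      _ ≤ 3 * U ^ 3 := by linarith [hpow (show 1 ≤ 3 by norm_num)]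
  have hgap0 := h.one_le_gap
  have hacc : 1 / I.acc ≤ 2 * U := by
    have : 1 / I.acc = 1 + 1 / I.α := by
      have := h.α_pos
      rw [acc]
      field_simp
      ring
    rw [this]
    linarith
  have hmod : 1 / I.modulus ≤ 2 * U := by
    have : 1 / I.modulus = 1 + 1 / I.σ := by
      have := h.σ_pos
      rw [modulus]
      field_simp
      ring
    rw [this]
    linarith
  have hacc0 := h.acc_pos
  have hmod0 := h.modulus_pos
  have hroom0 := h.room_pos
  have htol0 := h.tol_pos
  have herr0 := h.err_pos
  have htol : 1 / I.tol ≤ 112 * U ^ 5 := by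
    calc 1 / I.tol = 4 * (4 * I.gap + d * (I.R + 1)) * (1 / I.acc) * (1 / I.room) := by
          have := h.tol_den.ne'
          rw [tol]
          field_simp
      _ ≤ 4 * (4 * (3 * U ^ 3) + U * (U + 1)) * (2 * U) * U := by gcongr
      _ = 96 * U ^ 5 + 8 * U ^ 4 + 8 * U ^ 3 := by ring
      _ ≤ 112 * U ^ 5 := by
          linarith [hpow (show 4 ≤ 5 by norm_num), hpow (show 3 ≤ 5 by norm_num)]
  have herr : 1 / I.err ≤ 896 * U ^ 6 := by
    calc 1 / I.err = 4 * (d + 1) * (1 / I.tol) := by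
          rw [err]
          field_simp
      _ ≤ 4 * (U + U) * (112 * U ^ 5) := by gcongr
      _ = 896 * U ^ 6 := by ring
  have hrounds : I.rounds ≤ 700000 * U ^ 14 := by
    calc I.rounds = 8 * I.gap * (1 / I.modulus) * (1 / I.tol) ^ 2 + 1 := by
          rw [rounds]
          field_simp
      _ ≤ 8 * (3 * U ^ 3) * (2 * U) * (112 * U ^ 5) ^ 2 + 1 := by gcongr
      _ = 602112 * U ^ 14 + 1 := by ring
      _ ≤ 700000 * U ^ 14 := by linarith [hone 14]
  have hrounds0 := h.rounds_pos
  have hrceil : (⌈I.rounds⌉₊ : ℝ) ≤ 10 ^ 6 * U ^ 14 := by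
    linarith [(Nat.ceil_lt_add_one hrounds0.le).le, hone 14]
  have hbatch0 : 0 ≤ I.batch := by
    unfold batch
    positivity
  have hbatch : I.batch ≤ 27 * 10 ^ 12 * U ^ 29 := by
    calc I.batch = 4 * (I.R + 1) ^ 2 * (1 / I.err) ^ 2 * (2 * d * (I.rounds + 1) + I.lg) + 1 := by
          rw [batch]
          field_simp
      _ ≤ 4 * (U + U) ^ 2 * (896 * U ^ 6) ^ 2 *
            (2 * U * (700000 * U ^ 14 + U ^ 14) + 3 * U) + 1 := by
          gcongr
          exact hone 14
      _ ≤ 4 * (U + U) ^ 2 * (896 * U ^ 6) ^ 2 *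
            (2 * U * (700000 * U ^ 14 + U ^ 14) + 3 * U ^ 15) + U ^ 29 := by
          gcongr
          · exact (pow_one U).symm.le.trans (hpow (by norm_num))
          · exact hone 29
      _ ≤ 27 * 10 ^ 12 * U ^ 29 := by
          have := hone 29
          ring_nf
          linarith
  have hbceil : (⌈I.batch⌉₊ : ℝ) ≤ 28 * 10 ^ 12 * U ^ 29 := by
    linarith [(Nat.ceil_lt_add_one hbatch0).le, hone 29]
  have hU1 := hpow (show 1 ≤ 44 by norm_num)
  rw [pow_one] at hU1
  -- The leading term is rounds times batch size times goods, of degree `14 + 29 + 1 = 44`.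
  calc (I.time : ℝ) = d * 16 + I.pow * 4 + I.lg * 4 +
        ⌈I.rounds⌉₊ * (d * 16 + ⌈I.batch⌉₊ * (d * 4 + 8) + 22) + 60 := by
        rw [time]
        push_cast
        ring
    _ ≤ U * 16 + I.pow * 4 + 3 * U * 4 +
        10 ^ 6 * U ^ 14 * (U * 16 + 28 * 10 ^ 12 * U ^ 29 * (U * 4 + U * 8) + 22) + 60 := by
        gcongr
        linarith
    _ = U * 28 + I.pow * 4 + 16 * 10 ^ 6 * U ^ 15 + 336 * 10 ^ 18 * U ^ 44 +
        22 * 10 ^ 6 * U ^ 14 + 60 := by ring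
    _ ≤ U ^ 44 * 28 + 4 * I.pow * U ^ 44 + 16 * 10 ^ 6 * U ^ 44 + 336 * 10 ^ 18 * U ^ 44 +
        22 * 10 ^ 6 * U ^ 44 + 60 * U ^ 44 := by
        have h1 := hpow (show 15 ≤ 44 by norm_num)
        have h2 := hpow (show 14 ≤ 44 by norm_num)
        have h3 := mul_le_mul_of_nonneg_left (hone 44) (Nat.cast_nonneg (α := ℝ) I.pow)
        linarith [hone 44]
    _ ≤ (4 * I.pow + 10 ^ 21) * U ^ 44 := by
        have := hone 44
        linarith

/-- The degree depends on `β` only through `blow` in `1 / room`. Since `4 λ / acc ≤ 8 S ^ 2`, the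
quantity `U = 3 S (8 S ^ 2) ^ pow` dominates `1 / room` as well as `S`. -/
theorem Valid.time_le (h : I.Valid) {C : ℝ} (hC : ∀ j, I.c j ≤ C) (hC0 : 0 ≤ C) :
    (I.time : ℝ) ≤ (4 * I.pow + 10 ^ 21) * (3 * 8 ^ I.pow) ^ 44 *
      I.complexity C ^ ((2 * I.pow + 1) * 44) := by
  have hα : 0 < 1 / I.α := one_div_pos.2 h.α_pos
  have hσ : 0 < 1 / I.σ := one_div_pos.2 h.σ_pos
  have hγ : 0 < 1 / I.γ := one_div_pos.2 h.γ_pos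
  have hd : (0 : ℝ) ≤ d := Nat.cast_nonneg d
  have hδ : 0 < Real.log (1 / I.δ) := Real.log_pos ((one_lt_div h.δ_pos).2 h.δ_lt)
  have hlam := h.one_le_lam
  have hR := h.R_nonneg
  set S := I.complexity C with hSdef
  have hSeq : S = d + 1 / I.α + 1 / I.σ + I.lam + Real.log (1 / I.δ) + I.R + C + 1 / I.γ := rfl
  have hS : 1 ≤ S := by linarith
  have hS0 : 0 < S := by linarith
  set b := (8 * S ^ 2) ^ I.pow with hb
  have hb1 : 1 ≤ b := one_le_pow₀ (by nlinarith)
  set U := 3 * S * b with hU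
  have hSU : S ≤ U := by nlinarith
  have hacc : 1 / I.acc = 1 + 1 / I.α := by
    have := h.α_pos
    rw [acc]
    field_simp
    ring
  have hacc0 := h.acc_pos
  have hblow : I.blow ≤ b := by
    refine pow_le_pow_left₀ (by positivity) ?_ _
    calc 4 * I.lam / I.acc = 4 * I.lam * (1 / I.acc) := by ring
      _ ≤ 4 * S * (S + S) := by
          rw [hacc]
          gcongr
          · linarith
          · linarith
      _ = 8 * S ^ 2 := by ring
  have hroom : 1 / I.room ≤ U := by
    have hblow0 := h.blow_pos
    calc 1 / I.room = 1 / I.γ + 1 + d * I.blow := by rw [room, one_div_one_div]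
      _ ≤ S * b + S * b + S * b := by
          have h1 : S ≤ S * b := le_mul_of_one_le_right hS0.le hb1
          have h2 : d * I.blow ≤ S * b := by
            gcongr
            linarith
          linarith
      _ = U := by rw [hU]; ring
  have hc : ∑ j, I.c j ≤ U ^ 2 := by
    calc ∑ j, I.c j ≤ ∑ _j : Fin d, C := Finset.sum_le_sum fun j _ => hC j
      _ = d * C := by simp
      _ ≤ U * U := by
          gcongr <;> linarith
      _ = U ^ 2 := by ring
  refine (h.time_le_of_room (U := U) (by linarith) (by linarith) (by linarith) (by linarith)
    (by linarith) (by linarith [h.lg_le]) (by linarith) hc hroom).trans (le_of_eq ?_)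
  have hUeq : U = 3 * 8 ^ I.pow * S ^ (2 * I.pow + 1) := by
    rw [hU, hb, mul_pow, ← pow_mul, pow_succ]
    ring
  rw [hUeq, mul_pow, ← pow_mul]
  ring

end Input

end

end PostedPricing

/-! ### Assembly of the pricing theorem. -/

open PostedPricing in
theorem theorem3p9 :
    ∃ OWel : Prog, ∀ β : ℝ, 0 < β → β ≤ 1 →
      ∃ (K : ℝ) (k : ℕ), ∀ (d n : ℕ) (M : Market d n) (lam σ R : ℝ), M.Regular lam β σ R →
        ∀ (α δ γ : ℝ) (s : Fin d → ℝ), 0 < α → 0 < δ → δ < 1 → 0 < γ → M.HasSlack s γ →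
          ∃ price : (ℕ → Fin n) → Fin d → ℝ,
            (∀ ω : ℕ → Fin n, (∀ j, 0 ≤ price ω j) ∧
              ∃ (T q : ℕ) (m : Mem),
                Halts (M.rep ω) OWel (inputMem α δ lam β σ R γ s M.cost) T q m ∧
                m.vec d outArr = price ω ∧
                (T : ℝ) ≤ K * (d + 1 / α + 1 / σ + lam + Real.log (1 / δ)
                  + R + ‖M.cost‖ + 1 / γ) ^ k ∧
                (q : ℝ) ≤ K * (d + 1 / α + 1 / σ + lam + Real.log (1 / δ)
                  + R + ‖M.cost‖ + 1 / γ) ^ k) ∧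
            ENNReal.ofReal (1 - δ) ≤
              M.buyers {ω | (∀ j, M.expDemand (price ω) j ≤ s j) ∧
                M.welfare (price ω) ≥ M.optLottery s - α} := by
  refine ⟨pricingProg, fun β hβ hβ1 => ⟨(4 * ⌈1 / β⌉₊ + 10 ^ 21) * (3 * 8 ^ ⌈1 / β⌉₊) ^ 44,
    (2 * ⌈1 / β⌉₊ + 1) * 44, ?_⟩⟩
  intro d n M lam σ R hM α δ γ s hα hδ hδ1 hγ hs
  have hne : M.F.Nonempty := hs.imp fun x hx => hx.1
  set I : Input d := ⟨α, δ, lam, β, σ, R, γ, s, M.cost⟩ with hI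
  have h : I.Valid := ⟨hα, hδ, hδ1, hM.one_le_lam, hβ, hβ1, hM.sigma_pos, hM.nonneg_radius hne, hγ,
    hM.cost_nonneg⟩
  have hpos : ∀ j, I.s j < I.room → 0 < I.s j := fun j hj =>
    ((hM.exists_center hs h.room_le h.room_le_one).1 j hj).2
  have hnonneg : ∀ ω t j, 0 ≤ I.descent.traj (M.rep ω) t j := fun ω t j =>
    (hM.cost_nonneg j).trans (Input.low_le_traj h hpos t j)
  have htime := h.time_le (C := ‖M.cost‖)
    (fun j => (le_abs_self _).trans (PiLp.norm_apply_le M.cost j)) (norm_nonneg _)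
  refine ⟨fun ω => I.output (M.rep ω), fun ω => ⟨fun j => ?_, ?_⟩, ?_⟩
  · obtain ⟨u, -, -, hu, -⟩ := I.descent.stopped_eq (M.rep ω) ⌈I.rounds⌉₊ 0
    simp only [Input.output, hu]
    exact hnonneg ω u j
  · obtain ⟨q, m, hhalt, hout, hq⟩ := I.pricingProg_halts (M.rep ω) hβ hδ (hnonneg ω)
    exact ⟨I.time, q, m, hhalt, hout, htime, (Nat.cast_le.2 hq).trans htime⟩
  · exact (Input.measure_accurate hM h hne).trans (measure_mono fun ω hω =>
      Input.output_good hM h (fun _ => rfl) hs hω)
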